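/- Let $p$ be a prime, $\mathbb{F}_q$ a finite field of characteristic $p$, and let $\mathcal{D}=\mathbb{F}_q(t)\langle\partial\rangle$ be the ring of linear differential operators $\sum_i f_i\partial^i$ with $f_i\in\mathbb{F}_q(t)$, multiplied according to $\partial f=f\partial+\frac{\mathrm{d}f}{\mathrm{d}t}$; the order $\operatorname{ord}$ of a nonzero operator is its degree in $\partial$. Operators $L_1,L_2$ are coprime if $\mathcal{D}L_1+\mathcal{D}L_2=\mathcal{D}$, and $L=\mathrm{LCLM}_{i=1}^k L_i$ means $\mathcal{D}L=\bigcap_{i=1}^k\mathcal{D}L_i$ (an empty intersection being $\mathcal{D}$). An operator $L$ is decomposable if $L=\mathrm{LCLM}(L_1,L_2)$ for some coprime $L_1,L_2\in\mathcal{D}\setminus\mathbb{F}_q(t)$, and indecomposable otherwise. The $p$-curvature $\psi_p^L$ is the $\mathbb{F}_q(t)$-linear endomorphism of $\mathcal{D}/\mathcal{D}L$ given by left multiplication by $\partial^p$. The Frobenius invariants of an endomorphism $\varphi$ of a finite-dimensional $K$-vector space $V$ are the nonconstant monic polynomials $P_1\mid P_2\mid\dots\mid P_k$ in $K[Y]$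 such that $V\simeq\bigoplus_{i=1}^k K[Y]/(P_i)$ as a $K[Y]$-module, with $Y$ acting as $\varphi$. Let $N\in\mathbb{F}_q(t^p)[Y]$ be a monic irreducible polynomial that is separable over $\mathbb{F}_q(t^p)$, let $\nu\in\mathbb{N}$ (possibly $0$), and let $L\in\mathcal{D}$ be a monic (left or right) divisor of $N(\partial^p)^\nu$. 1. If $N(\partial^p)$ is irreducible in $\mathcal{D}$, then $L=N(\partial^p)^m$ for some integer $0\le m\leq\nu$, and $L$ is indecomposable. 2. If $N(\partial^p)$ is not irreducible in $\mathcal{D}$, then the Frobenius invariants of $\psi_p^L$ are of the form $N^{\nu_1}\mid N^{\nu_2}\mid\dots\mid N^{\nu_k}$, and there exist $L_1,\dots,L_k\in\mathcal{D}$ such that (i) $L=\mathrm{LCLM}_{i=1}^k L_i$ and $\operatorname{ord}L=\sum_{i=1}^k\operatorname{ord}L_i$; (ii) $\operatorname{ord}L_i=\nu_i\deg N$ for all $i\in\{1,\dots,k\}$; (iii) each $L_i$ is indecomposable. -/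

import Mathlib

open Polynomial

noncomputable section

/-! ### The derivation `d/dt` of the rational function field `F(t)` -/

section Derivation

variable {F : Type*} [Field F]

/-- The usual quotient rule: `d/dt (a / b) = (a' b - a b') / b ^ 2`, for the reduced fraction. -/
def ddtFun (f : RatFunc F) : RatFunc F :=
  algebraMap F[X] (RatFunc F)
      (derivative f.num * f.denom - f.num * derivative f.denom) /
    algebraMap F[X] (RatFunc F) (f.denom ^ 2)

theorem ddtFun_div (a : F[X]) {b : F[X]} (hb : b ≠ 0) :
    ddtFun (algebraMap F[X] (RatFunc F) a / algebraMap F[X] (RatFunc F) b) =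
      algebraMap F[X] (RatFunc F) (derivative a * b - a * derivative b) /
        algebraMap F[X] (RatFunc F) (b ^ 2) := by
  set f : RatFunc F := algebraMap F[X] (RatFunc F) a / algebraMap F[X] (RatFunc F) b with hf
  have hd : f.denom ≠ 0 := f.denom_ne_zero
  have hinj := RatFunc.algebraMap_injective F
  have hd' : algebraMap F[X] (RatFunc F) f.denom ≠ 0 := by
    simpa using hd
  have hb' : algebraMap F[X] (RatFunc F) b ≠ 0 := by
    simpa using hb
  have key : a * f.denom = f.num * b := by
    apply hinj
    have h := f.num_div_denom
    rw [hf, ← hf, div_eq_div_iff hd' hb'] at h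
    rw [map_mul, map_mul, h]
  have key' : derivative a * f.denom + a * derivative f.denom =
      derivative f.num * b + f.num * derivative b := by
    have := congrArg derivative key
    simpa [derivative_mul] using this
  unfold ddtFun
  rw [div_eq_div_iff (by simpa using hd) (by simpa using hb), ← map_mul, ← map_mul]
  congr 1
  linear_combination (-b * f.denom) * key' + (b * derivative f.denom + f.denom * derivative b) * key

/-- The derivation `d/dt` of `F(t)`. -/
def ddt : Derivation F (RatFunc F) (RatFunc F) :=
  Derivation.mk'
    { toFun := ddtFun
      map_add' := by
        intro f g
        have hf : algebraMap F[X] (RatFunc F) f.denom ≠ 0 := by simpa using f.denom_ne_zero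
        have hg : algebraMap F[X] (RatFunc F) g.denom ≠ 0 := by simpa using g.denom_ne_zero
        have h : f + g = algebraMap F[X] (RatFunc F) (f.num * g.denom + f.denom * g.num) /
            algebraMap F[X] (RatFunc F) (f.denom * g.denom) := by
          conv_lhs => rw [← f.num_div_denom, ← g.num_div_denom]
          rw [div_add_div _ _ hf hg]
          simp
        rw [h, ddtFun_div _ (mul_ne_zero f.denom_ne_zero g.denom_ne_zero)]
        unfold ddtFun
        simp only [map_add, map_sub, map_mul, map_pow, derivative_mul]
        field_simp
        ring
      map_smul' := by
        intro c f
        have h : c • f = algebraMap F[X] (RatFunc F) (c • f.num) /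
            algebraMap F[X] (RatFunc F) f.denom := by
          rw [RatFunc.div_smul, f.num_div_denom]
        rw [h, ddtFun_div _ f.denom_ne_zero, RingHom.id_apply, ddtFun, derivative_smul,
          ← RatFunc.div_smul, smul_sub, smul_mul_assoc, smul_mul_assoc] }
    (by
      intro f g
      have hf : algebraMap F[X] (RatFunc F) f.denom ≠ 0 := by simpa using f.denom_ne_zero
      have hg : algebraMap F[X] (RatFunc F) g.denom ≠ 0 := by simpa using g.denom_ne_zero
      have h : f * g = algebraMap F[X] (RatFunc F) (f.num * g.num) /
          algebraMap F[X] (RatFunc F) (f.denom * g.denom) := by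
        conv_lhs => rw [← f.num_div_denom, ← g.num_div_denom]
        rw [div_mul_div_comm]
        simp
      change ddtFun (f * g) = f • ddtFun g + g • ddtFun f
      rw [h, ddtFun_div _ (mul_ne_zero f.denom_ne_zero g.denom_ne_zero)]
      conv_rhs => rw [smul_eq_mul, smul_eq_mul]
      conv_rhs =>
        enter [1, 1]
        rw [← f.num_div_denom]
      conv_rhs =>
        enter [2, 1]
        rw [← g.num_div_denom]
      unfold ddtFun
      simp only [map_add, map_sub, map_mul, map_pow, derivative_mul]
      field_simp
      ring)

theorem ddt_div (a : F[X]) {b : F[X]} (hb : b ≠ 0) :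
    ddt (algebraMap F[X] (RatFunc F) a / algebraMap F[X] (RatFunc F) b) =
      algebraMap F[X] (RatFunc F) (derivative a * b - a * derivative b) /
        algebraMap F[X] (RatFunc F) (b ^ 2) :=
  ddtFun_div a hb

theorem ddt_algebraMap (a : F[X]) :
    ddt (algebraMap F[X] (RatFunc F) a) = algebraMap F[X] (RatFunc F) (derivative a) := by
  have := ddt_div a (one_ne_zero (α := F[X]))
  simpa using this

/-- In characteristic `p`, the `p`-th iterate of `d/dt` vanishes on `F(t)`. -/
theorem ddt_iterate_char (p : ℕ) [hp : Fact p.Prime] [CharP F p] (f : RatFunc F) :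
    (⇑(ddt (F := F)))^[p] f = 0 := by
  have hpow : ∀ g : RatFunc F, ddt (g ^ p) = 0 := by
    intro g
    have : CharP (RatFunc F) p := charP_of_injective_algebraMap (algebraMap F (RatFunc F)).injective p
    rw [Derivation.leibniz_pow, ← Nat.cast_smul_eq_nsmul (RatFunc F), CharP.cast_eq_zero, zero_smul]
  have hscal : ∀ (g h : RatFunc F) (n : ℕ),
      (⇑(ddt (F := F)))^[n] (g ^ p * h) = g ^ p * (⇑(ddt (F := F)))^[n] h := by
    intro g h n
    induction n with
    | zero => rfl
    | succ n ih =>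
      rw [Function.iterate_succ_apply', ih, Derivation.leibniz, hpow, smul_zero, add_zero,
        Function.iterate_succ_apply', smul_eq_mul]
  have hpoly : ∀ (a : F[X]) (n : ℕ), (⇑(ddt (F := F)))^[n] (algebraMap F[X] (RatFunc F) a) =
      algebraMap F[X] (RatFunc F) (derivative^[n] a) := by
    intro a n
    induction n with
    | zero => rfl
    | succ n ih => rw [Function.iterate_succ_apply', ih, ddt_algebraMap,
        Function.iterate_succ_apply']
  have hd : algebraMap F[X] (RatFunc F) f.denom ≠ 0 := by simpa using f.denom_ne_zero
  have h : f = (algebraMap F[X] (RatFunc F) f.denom)⁻¹ ^ p *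
      algebraMap F[X] (RatFunc F) (f.num * f.denom ^ (p - 1)) := by
    conv_lhs => rw [← f.num_div_denom]
    obtain ⟨m, rfl⟩ : ∃ m, p = m + 1 := ⟨p - 1, (Nat.succ_pred_eq_of_pos hp.out.pos).symm⟩
    simp only [map_mul, map_pow, Nat.add_sub_cancel, inv_pow]
    field_simp
    ring
  rw [h, hscal, hpoly, ← factorial_smul_hasseDeriv]
  have : ((p.factorial : ℕ) : F[X]) = 0 := by
    rw [CharP.cast_eq_zero_iff F[X] p]
    exact Nat.dvd_factorial hp.out.pos le_rfl
  rw [LinearMap.smul_apply, ← Nat.cast_smul_eq_nsmul F[X], this, zero_smul, map_zero, mul_zero]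

end Derivation

/-! ### The ring `F(t)⟨∂⟩` of linear differential operators -/

/-- Linear differential operators `∑ fᵢ ∂ⁱ` with `fᵢ ∈ F(t)`. The underlying additive group is that
of polynomials in `∂` with coefficients (written on the left) in `F(t)`; the multiplication, defined
below, is the noncommutative one given by `∂ f = f ∂ + f'`. -/
def DiffOp (F : Type*) [Field F] : Type _ := (RatFunc F)[X]

namespace DiffOp

variable {F : Type*} [Field F]

theorem end_mul_apply {A : Type*} [AddCommMonoid A] (f g : AddMonoid.End A) (x : A) :
    (f * g) x = f (g x) := rfl

theorem end_add_apply {A : Type*} [AddCommMonoid A] (f g : AddMonoid.End A) (x : A) :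
    (f + g) x = f x + g x := rfl

theorem end_zero_apply {A : Type*} [AddCommMonoid A] (x : A) :
    (0 : AddMonoid.End A) x = 0 := rfl

instance : AddCommGroup (DiffOp F) := inferInstanceAs (AddCommGroup (RatFunc F)[X])

/-- The polynomial `∑ fᵢ Xⁱ` of coefficients of the operator `∑ fᵢ ∂ⁱ`. -/
def toPoly : DiffOp F ≃+ (RatFunc F)[X] := AddEquiv.refl _

/-- Left multiplication by `∂`: it maps `∑ fᵢ ∂ⁱ` to `∑ (fᵢ ∂ⁱ⁺¹ + fᵢ' ∂ⁱ)`. -/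
def delMul : AddMonoid.End (RatFunc F)[X] where
  toFun M := M.sum fun i f => monomial (i + 1) f + monomial i (ddt f)
  map_zero' := by simp
  map_add' M N := by
    apply Polynomial.sum_add_index
    · simp
    · intro i a b
      simp only [map_add]
      abel

/-- Left multiplication by a coefficient `f ∈ F(t)`. -/
def coeffMul (f : RatFunc F) : AddMonoid.End (RatFunc F)[X] := AddMonoidHom.mulLeft (C f)

theorem coeffMul_apply (f : RatFunc F) (M : (RatFunc F)[X]) : coeffMul f M = C f * M := rfl

theorem coeffMul_add (f g : RatFunc F) : coeffMul (f + g) = coeffMul f + coeffMul g := by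
  ext1 M
  rw [end_add_apply, coeffMul_apply, coeffMul_apply, coeffMul_apply, C_add, add_mul]

theorem coeffMul_zero : coeffMul (0 : RatFunc F) = 0 := by
  ext1 M
  rw [coeffMul_apply, end_zero_apply, C_0, zero_mul]

theorem coeffMul_mul (f g : RatFunc F) : coeffMul (f * g) = coeffMul f * coeffMul g := by
  ext1 M
  rw [end_mul_apply, coeffMul_apply, coeffMul_apply, coeffMul_apply, C_mul, mul_assoc]

theorem coeffMul_one : coeffMul (1 : RatFunc F) = 1 := by
  ext1 M
  rw [coeffMul_apply, C_1, one_mul]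
  rfl

theorem coeffMul_monomial (g : RatFunc F) (i : ℕ) (f : RatFunc F) :
    coeffMul g (monomial i f) = monomial i (g * f) := by
  rw [coeffMul_apply, C_mul_monomial]

/-- Left multiplication by the operator `∑ fᵢ ∂ⁱ`. -/
def leftMul : (RatFunc F)[X] →+ AddMonoid.End (RatFunc F)[X] where
  toFun L := L.sum fun i f => coeffMul f * delMul ^ i
  map_zero' := by simp
  map_add' L M := by
    apply Polynomial.sum_add_index
    · intro i
      rw [coeffMul_zero, zero_mul]
    · intro i a b
      rw [coeffMul_add, add_mul]

theorem delMul_monomial (i : ℕ) (f : RatFunc F) :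
    delMul (monomial i f) = monomial (i + 1) f + monomial i (ddt f) := by
  change (monomial i f).sum (fun i f => monomial (i + 1) f + monomial i (ddt f)) = _
  rw [Polynomial.sum_monomial_index]
  simp

theorem leftMul_monomial (i : ℕ) (f : RatFunc F) :
    leftMul (monomial i f) = coeffMul f * delMul ^ i := by
  change (monomial i f).sum (fun i f => coeffMul f * delMul ^ i) = _
  rw [Polynomial.sum_monomial_index]
  rw [coeffMul_zero, zero_mul]

/-- The commutation rule `∂ f = f ∂ + f'`. -/
theorem delMul_mul_coeffMul (f : RatFunc F) :
    delMul * coeffMul f = coeffMul f * delMul + coeffMul (ddt f) := by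
  refine Polynomial.addHom_ext fun i a => ?_
  change delMul (coeffMul f (monomial i a)) =
    coeffMul f (delMul (monomial i a)) + coeffMul (ddt f) (monomial i a)
  rw [coeffMul_monomial, delMul_monomial, delMul_monomial, map_add, coeffMul_monomial,
    coeffMul_monomial, coeffMul_monomial, Derivation.leibniz, map_add, add_assoc]
  simp [mul_comm]

theorem leftMul_coeffMul (f : RatFunc F) (M : (RatFunc F)[X]) :
    leftMul (coeffMul f M) = coeffMul f * leftMul M := by
  induction M using Polynomial.induction_on' with
  | add p q hp hq => rw [map_add, map_add, hp, hq, map_add, mul_add]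
  | monomial i a =>
    rw [coeffMul_monomial, leftMul_monomial, leftMul_monomial, coeffMul_mul, mul_assoc]

theorem leftMul_delMul (M : (RatFunc F)[X]) : leftMul (delMul M) = delMul * leftMul M := by
  induction M using Polynomial.induction_on' with
  | add p q hp hq => rw [map_add, map_add, hp, hq, map_add, mul_add]
  | monomial i a =>
    rw [delMul_monomial, map_add, leftMul_monomial, leftMul_monomial, leftMul_monomial,
      ← mul_assoc delMul, delMul_mul_coeffMul, add_mul, pow_succ', mul_assoc]

theorem leftMul_delMul_pow (n : ℕ) (M : (RatFunc F)[X]) :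
    leftMul ((delMul ^ n) M) = delMul ^ n * leftMul M := by
  induction n with
  | zero => simp
  | succ n ih =>
    rw [pow_succ', end_mul_apply, leftMul_delMul, ih, mul_assoc]

theorem leftMul_leftMul (L M : (RatFunc F)[X]) : leftMul (leftMul L M) = leftMul L * leftMul M := by
  induction L using Polynomial.induction_on' with
  | add p q hp hq =>
    rw [map_add, end_add_apply, map_add, hp, hq, add_mul]
  | monomial i a =>
    rw [leftMul_monomial, end_mul_apply, leftMul_coeffMul, leftMul_delMul_pow, mul_assoc]

theorem delMul_pow_one (n : ℕ) : (delMul ^ n) (1 : (RatFunc F)[X]) = X ^ n := by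
  induction n with
  | zero => simp
  | succ n ih =>
    rw [pow_succ', end_mul_apply, ih, X_pow_eq_monomial, delMul_monomial]
    simp [X_pow_eq_monomial]

instance : One (DiffOp F) := ⟨toPoly.symm 1⟩

/-- The product of operators. -/
instance : Mul (DiffOp F) := ⟨fun L M => toPoly.symm (leftMul (toPoly L) (toPoly M))⟩

theorem toPoly_mul (L M : DiffOp F) : toPoly (L * M) = leftMul (toPoly L) (toPoly M) := rfl

theorem toPoly_one : toPoly (1 : DiffOp F) = 1 := rfl

instance : Ring (DiffOp F) :=
  { (inferInstance : AddCommGroup (DiffOp F)), (inferInstance : One (DiffOp F)),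
    (inferInstance : Mul (DiffOp F)) with
    left_distrib := fun L M N => toPoly.injective <| by
      simp only [toPoly_mul, map_add]
    right_distrib := fun L M N => toPoly.injective <| by
      simp only [toPoly_mul, map_add, end_add_apply]
    zero_mul := fun L => toPoly.injective <| by
      simp only [toPoly_mul, map_zero, end_zero_apply]
    mul_zero := fun L => toPoly.injective <| by
      simp only [toPoly_mul, map_zero]
    mul_assoc := fun L M N => toPoly.injective <| by
      simp only [toPoly_mul, leftMul_leftMul, end_mul_apply]
    one_mul := fun L => toPoly.injective <| by
      rw [toPoly_mul, toPoly_one, ← monomial_zero_one, leftMul_monomial, coeffMul_one]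
      simp
    mul_one := fun L => toPoly.injective <| by
      rw [toPoly_mul, toPoly_one]
      generalize toPoly L = P
      induction P using Polynomial.induction_on' with
      | add p q hp hq => rw [map_add, end_add_apply, hp, hq]
      | monomial i a =>
        rw [leftMul_monomial, end_mul_apply, delMul_pow_one, X_pow_eq_monomial,
          coeffMul_monomial, mul_one] }

/-- A rational function, viewed as an operator of order `0`. -/
def coeff : RatFunc F →+* DiffOp F where
  toFun f := toPoly.symm (C f)
  map_zero' := by simp
  map_one' := rfl
  map_add' f g := by simp
  map_mul' f g := toPoly.injective <| by
    rw [toPoly_mul]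
    simp only [AddEquiv.apply_symm_apply]
    rw [← monomial_zero_left, ← monomial_zero_left, ← monomial_zero_left, leftMul_monomial,
      pow_zero, mul_one, coeffMul_monomial]

theorem toPoly_coeff (f : RatFunc F) : toPoly (coeff f) = C f := rfl

/-- The operator `∂`. -/
def del : DiffOp F := toPoly.symm X

theorem toPoly_del : toPoly (del : DiffOp F) = X := rfl

/-- The Leibniz rule `∂ f = f ∂ + f'`. -/
theorem del_mul_coeff (f : RatFunc F) : del * coeff f = coeff f * del + coeff (ddt f) := by
  apply toPoly.injective
  rw [map_add, toPoly_mul, toPoly_mul, toPoly_del, toPoly_coeff, toPoly_coeff]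
  rw [← monomial_one_one_eq_X, ← monomial_zero_left, ← monomial_zero_left, leftMul_monomial,
    leftMul_monomial, coeffMul_one, one_mul, pow_one, pow_zero, mul_one, delMul_monomial,
    coeffMul_monomial, mul_one, zero_add]

/-- Every operator is the sum `∑ fᵢ ∂ⁱ` given by its coefficients. -/
theorem eq_sum (L : DiffOp F) : L = (toPoly L).sum fun i f => coeff f * del ^ i := by
  have hdel : ∀ M : DiffOp F, toPoly (del * M) = delMul (toPoly M) := by
    intro M
    rw [toPoly_mul, toPoly_del, ← monomial_one_one_eq_X, leftMul_monomial,
      coeffMul_one, one_mul, pow_one]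
  have hpow : ∀ i : ℕ, toPoly ((del : DiffOp F) ^ i) = X ^ i := by
    intro i
    rw [← delMul_pow_one]
    induction i with
    | zero => simp [toPoly_one]
    | succ n ih => rw [pow_succ', hdel, ih, pow_succ', end_mul_apply]
  apply toPoly.injective
  rw [Polynomial.sum_def, map_sum]
  conv_lhs => rw [(toPoly L).as_sum_support]
  refine Finset.sum_congr rfl fun i _ => ?_
  rw [toPoly_mul, hpow, toPoly_coeff, ← monomial_zero_left, leftMul_monomial, pow_zero, mul_one,
    X_pow_eq_monomial, coeffMul_monomial, mul_one]

/-- The order of an operator (only meaningful for nonzero operators). -/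
def ord (L : DiffOp F) : ℕ := (toPoly L).natDegree

/-- An operator is monic if its leading coefficient is `1`. -/
def Monic (L : DiffOp F) : Prop := (toPoly L).Monic

/-- `F(t)⟨∂⟩` is an `F(t)`-vector space, by multiplication on the left. -/
instance : Module (RatFunc F) (DiffOp F) := Module.compHom (DiffOp F) (coeff (F := F))

theorem smul_def (f : RatFunc F) (L : DiffOp F) : f • L = coeff f * L := rfl

instance : IsScalarTower (RatFunc F) (DiffOp F) (DiffOp F) :=
  ⟨fun f L M => by rw [smul_def, smul_def, smul_eq_mul, smul_eq_mul, mul_assoc]⟩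

/-! ### Left ideals, `LCLM`, `GCRD`, indecomposable operators -/

/-- The left ideal `F(t)⟨∂⟩ L`. -/
abbrev leftIdeal (L : DiffOp F) : Submodule (DiffOp F) (DiffOp F) := Submodule.span (DiffOp F) {L}

/-- The left `F(t)⟨∂⟩`-module `𝒟_L = F(t)⟨∂⟩ / F(t)⟨∂⟩ L`. -/
abbrev QuotModule (L : DiffOp F) : Type _ := DiffOp F ⧸ leftIdeal L

/-- `L` is a least common left multiple of the family `(Lᵢ)`:
`F(t)⟨∂⟩ L = ⋂ F(t)⟨∂⟩ Lᵢ`. -/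
def IsLCLM {ι : Type*} (L : DiffOp F) (Li : ι → DiffOp F) : Prop :=
  leftIdeal L = ⨅ i, leftIdeal (Li i)

/-- `G` is a greatest common right divisor of `L₁` and `L₂`:
`F(t)⟨∂⟩ G = F(t)⟨∂⟩ L₁ + F(t)⟨∂⟩ L₂`. -/
def IsGCRD (G L₁ L₂ : DiffOp F) : Prop :=
  leftIdeal G = leftIdeal L₁ ⊔ leftIdeal L₂

/-- `L` is decomposable if it is the `LCLM` of two coprime operators that do not lie in `F(t)`. -/
def Decomposable (L : DiffOp F) : Prop :=
  ∃ L₁ L₂ : DiffOp F, L₁ ∉ Set.range (coeff (F := F)) ∧ L₂ ∉ Set.range (coeff (F := F)) ∧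
    IsGCRD 1 L₁ L₂ ∧ IsLCLM L ![L₁, L₂]

/-- `L` is indecomposable if it is not decomposable. -/
def Indecomposable (L : DiffOp F) : Prop := ¬ Decomposable L

/-! ### The `p`-curvature -/

section PCurvature

variable (p : ℕ) [Fact p.Prime] [CharP F p]

theorem del_pow_mul_coeff (f : RatFunc F) : del ^ p * coeff f = coeff f * del ^ p := by
  have : CharP (RatFunc F) p :=
    charP_of_injective_algebraMap (algebraMap F (RatFunc F)).injective p
  have : CharP (DiffOp F) p := by
    have : Nontrivial (DiffOp F) := inferInstanceAs (Nontrivial (RatFunc F)[X])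
    exact charP_of_injective_ringHom (coeff (F := F)).injective p
  have : CharP (AddMonoid.End (DiffOp F)) p := by
    refine ⟨fun n => ?_⟩
    rw [← CharP.cast_eq_zero_iff (DiffOp F) p n]
    constructor
    · intro h
      have := DFunLike.congr_fun h (1 : DiffOp F)
      simpa using this
    · intro h
      ext1 M
      have h2 : ((n : ℕ) : AddMonoid.End (DiffOp F)) M = n • M := rfl
      rw [h2, nsmul_eq_mul, h, zero_mul]
      rfl
  let l : AddMonoid.End (DiffOp F) := AddMonoidHom.mulLeft del
  let r : AddMonoid.End (DiffOp F) := AddMonoidHom.mulRight del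
  have hlr : Commute l r := by
    change l * r = r * l
    ext1 M
    change del * (M * del) = del * M * del
    rw [mul_assoc]
  have hl : ∀ (n : ℕ) (M : DiffOp F), (l ^ n) M = del ^ n * M := by
    intro n M
    induction n with
    | zero => simp
    | succ n ih => rw [pow_succ', end_mul_apply, ih, pow_succ', mul_assoc]; rfl
  have hr : ∀ (n : ℕ) (M : DiffOp F), (r ^ n) M = M * del ^ n := by
    intro n M
    induction n with
    | zero => simp
    | succ n ih => rw [pow_succ', end_mul_apply, ih, pow_succ, ← mul_assoc]; rfl
  have had : ∀ n : ℕ, ((l - r) ^ n) (coeff f) = coeff ((⇑(ddt (F := F)))^[n] f) := by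
    intro n
    induction n with
    | zero => simp
    | succ n ih =>
      rw [pow_succ', end_mul_apply, ih, Function.iterate_succ_apply']
      change del * _ - _ * del = _
      rw [del_mul_coeff]
      abel
  have h := had p
  rw [sub_pow_char_of_commute (p := p) hlr, ddt_iterate_char, map_zero] at h
  have h' : (l ^ p) (coeff f) - (r ^ p) (coeff f) = 0 := h
  rw [hl, hr] at h'
  exact sub_eq_zero.mp h'

/-- The `p`-curvature of `L`: the `F(t)`-linear endomorphism of `𝒟_L` given by multiplication by
`∂ ^ p`. -/
def pCurvature (L : DiffOp F) : Module.End (RatFunc F) (QuotModule L) where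
  toFun x := (del ^ p : DiffOp F) • x
  map_add' x y := smul_add _ x y
  map_smul' f x := by
    have h : ∀ y : QuotModule L, f • y = (coeff f : DiffOp F) • y := by
      intro y
      rw [← one_smul (DiffOp F) y, ← smul_assoc, smul_def, mul_one, one_smul]
    rw [RingHom.id_apply, h, h, smul_smul, smul_smul, del_pow_mul_coeff]

end PCurvature

/-! ### Central operators -/

/-- The field `F(t ^ p)`, as a subfield of `F(t)`. -/
abbrev ConstField (F : Type*) [Field F] (p : ℕ) : IntermediateField F (RatFunc F) :=
  IntermediateField.adjoin F {RatFunc.X ^ p}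

/-- The operator `N(∂ ^ p) = ∑ nᵢ ∂ ^ (p i)` for a polynomial `N = ∑ nᵢ Yⁱ` over `F(t ^ p)`. -/
def evalDelPow (p : ℕ) (N : (ConstField F p)[X]) : DiffOp F :=
  N.eval₂ ((coeff (F := F)).comp (algebraMap (ConstField F p) (RatFunc F))) (del ^ p)

end DiffOp

/-- `P₁ ∣ P₂ ∣ ⋯ ∣ P_k` are the Frobenius invariants (invariant factors) of the endomorphism `φ` of
the `K`-vector space `V`: they are monic and nonconstant, each one divides the next one, and
`V`, with `Y` acting by `φ`, is isomorphic to `⨁ K[Y]/(Pᵢ)` as a `K[Y]`-module. -/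
def IsFrobeniusInvariants {K V : Type*} [Field K] [AddCommGroup V] [Module K V]
    (φ : Module.End K V) {k : ℕ} (P : Fin k → K[X]) : Prop :=
  (∀ i, (P i).Monic ∧ 0 < (P i).natDegree) ∧ (∀ i j, i ≤ j → P i ∣ P j) ∧
    Nonempty (Module.AEval' φ ≃ₗ[K[X]] ((i : Fin k) → K[X] ⧸ Ideal.span {P i}))

end

/-!
Write `K = F(t)`, `C = F(t ^ p)` and `𝒟 = F(t)⟨∂⟩`. Polynomials in `∂ ^ p` with coefficients in `K`
form a commutative subring `K[∂ ^ p]` (`DiffOp.evalDel`), on which `∂` acts by differentiating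
coefficients, so polynomials with coefficients in `C` are central. A polynomial `N` that is
irreducible and separable over `C` remains irreducible over `K` (`DiffOp.irreducible_map`).

If `N(∂ ^ p)` is irreducible, the greatest common right divisor of an operator with `N(∂ ^ p)` is
`1` or `N(∂ ^ p)`; as `N(∂ ^ p)` is central, the divisors of `N(∂ ^ p) ^ ν` are its powers up to
units (`DiffOp.exists_unit_mul_pow`), and two of positive order are never coprime.

If `N(∂ ^ p)` is reducible, the ring `𝒟 / 𝒟 N(∂ ^ p)` has no nonzero proper two-sided ideal and
has dimension `p` over the field `K[Y]/(N)`. It is a direct sum of `n` copies of a simple module, and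
`n ∣ p`, `n ≠ 1`, so the simple module is one-dimensional over `K[Y]/(N)`. On a generator `∂` acts
as some `f ∈ K[Y]` (`DiffOp.exists_del_smul_eq`), which means that `(∂ - f(∂ ^ p)) ^ p` vanishes
modulo `N(∂ ^ p)`. Since `(∂ - u) ^ p = ∂ ^ p + ((d/dt - u) ^ p 1)` for `u ∈ K[∂ ^ p]`, and since
constants are `(p - 1)`-st derivatives, Hensel's lemma improves `f` so that this holds modulo any
power of `N(∂ ^ p)` (`DiffOp.exists_lift`).

On `M = 𝒟 / 𝒟 L` the operator `∇ = ∂ - f(∂ ^ p)` is then nilpotent with `∇ ^ p = 0`, so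
`M = ⨁ tⁱ ker ∇` for `i < p` and `M` is obtained from the `C[Y]`-module `ker ∇` by extension of
scalars. The structure theorem for `ker ∇` gives `M = ⨁ K[Y] wᵢ` with `K[Y] wᵢ ≃ K[Y]/(N ^ eᵢ)` and
`∇ wᵢ = 0` (`DiffOp.exists_generators`). The `eᵢ ≠ 0` are the exponents of the Frobenius invariants,
which are unique because the dimensions of the spaces `N ^ j M` determine them
(`IsPrimaryBasis.exists_equiv`). The summands are stable under `∂`, and the annihilators of the
components of `1` generate the operators `Lᵢ` (`DiffOp.exists_decomposition`); they are
indecomposable because `K[Y]/(N ^ eᵢ)` is not a sum of two proper submodules.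
-/

set_option linter.unusedSectionVars false

noncomputable section

namespace DiffOp

/-! ### Order, division and left ideals -/

section Euclidean

variable {F : Type*} [Field F]

theorem toPoly_coeff_mul (f : RatFunc F) (L : DiffOp F) :
    toPoly (coeff f * L) = C f * toPoly L := by
  rw [toPoly_mul, toPoly_coeff, ← monomial_zero_left, leftMul_monomial, pow_zero, mul_one,
    coeffMul_apply, monomial_zero_left]

theorem toPoly_smul (f : RatFunc F) (L : DiffOp F) : toPoly (f • L) = f • toPoly L := by
  rw [smul_def, toPoly_coeff_mul, smul_eq_C_mul]

/-- The derivation of `F(t)[Y]` that acts by `d/dt` on coefficients and maps `Y` to `0`, as an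
additive map. -/
def ddtCoeff : (RatFunc F)[X] →+ (RatFunc F)[X] where
  toFun P := P.sum fun i f => monomial i (ddt f)
  map_zero' := by simp
  map_add' P Q := by
    apply Polynomial.sum_add_index
    · simp
    · simp

theorem ddtCoeff_monomial (i : ℕ) (f : RatFunc F) :
    ddtCoeff (monomial i f) = monomial i (ddt f) := by
  change (monomial i f).sum (fun i f => monomial i (ddt f)) = _
  rw [Polynomial.sum_monomial_index]
  simp

theorem ddtCoeff_coeff (P : (RatFunc F)[X]) (i : ℕ) :
    (ddtCoeff P).coeff i = ddt (P.coeff i) := by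
  induction P using Polynomial.induction_on' with
  | add P Q hP hQ => simp [hP, hQ]
  | monomial j f =>
    rw [ddtCoeff_monomial, coeff_monomial, coeff_monomial]
    split_ifs <;> simp

theorem natDegree_ddtCoeff_le (P : (RatFunc F)[X]) : (ddtCoeff P).natDegree ≤ P.natDegree := by
  rw [natDegree_le_iff_coeff_eq_zero]
  intro i hi
  rw [ddtCoeff_coeff, coeff_eq_zero_of_natDegree_lt hi, map_zero]

theorem toPoly_del_mul (L : DiffOp F) :
    toPoly (del * L) = X * toPoly L + ddtCoeff (toPoly L) := by
  rw [toPoly_mul, toPoly_del, ← monomial_one_one_eq_X, leftMul_monomial,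
      coeffMul_one, one_mul, pow_one]
  induction toPoly L using Polynomial.induction_on' with
  | add P Q hP hQ =>
    rw [map_add, hP, hQ, map_add]
    ring
  | monomial i f =>
    rw [delMul_monomial, ddtCoeff_monomial, monomial_mul_monomial, one_mul, add_comm 1 i]

theorem toPoly_del_pow_mul_le (n : ℕ) (L : DiffOp F) (m : ℕ) (hL : (toPoly L).natDegree ≤ m) :
    (toPoly (del ^ n * L)).natDegree ≤ n + m ∧
      (toPoly (del ^ n * L)).coeff (n + m) = (toPoly L).coeff m := by
  induction n with
  | zero => simpa using hL
  | succ n ih =>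
    rw [pow_succ', mul_assoc, toPoly_del_mul]
    have h1 := natDegree_ddtCoeff_le (toPoly (del ^ n * L))
    constructor
    · refine (natDegree_add_le _ _).trans (max_le ?_ (by omega))
      refine natDegree_mul_le.trans ?_
      rw [natDegree_X]
      omega
    · rw [show n + 1 + m = n + m + 1 by ring, coeff_add, coeff_X_mul, ih.2,
        coeff_eq_zero_of_natDegree_lt (n := n + m + 1) (by omega), add_zero]

theorem toPoly_mul_le (L M : DiffOp F) (m : ℕ) (hM : (toPoly M).natDegree ≤ m) :
    (toPoly (L * M)).natDegree ≤ L.ord + m ∧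
      (toPoly (L * M)).coeff (L.ord + m) = (toPoly L).leadingCoeff * (toPoly M).coeff m := by
  have h : toPoly (L * M) = ∑ i ∈ Finset.range (L.ord + 1),
      C ((toPoly L).coeff i) * toPoly (del ^ i * M) := by
    conv_lhs => rw [eq_sum L, Polynomial.sum_over_range _ (by simp), Finset.sum_mul, map_sum]
    exact Finset.sum_congr rfl fun i _ => by rw [mul_assoc, toPoly_coeff_mul]
  rw [h]
  constructor
  · refine natDegree_sum_le_of_forall_le _ _ fun i hi => ?_
    refine natDegree_C_mul_le _ _ |>.trans ?_
    have := (toPoly_del_pow_mul_le i M m hM).1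
    have := Finset.mem_range.1 hi
    omega
  · rw [finsetSum_coeff, Finset.sum_range_succ, coeff_C_mul, (toPoly_del_pow_mul_le _ M m hM).2,
      Finset.sum_eq_zero, zero_add]
    · rfl
    · intro i hi
      have := (toPoly_del_pow_mul_le i M m hM).1
      have := Finset.mem_range.1 hi
      rw [coeff_C_mul, coeff_eq_zero_of_natDegree_lt (p := toPoly (del ^ i * M)) (by omega),
        mul_zero]

theorem leadingCoeff_mul (L M : DiffOp F) : (toPoly (L * M)).coeff (L.ord + M.ord) =
    (toPoly L).leadingCoeff * (toPoly M).leadingCoeff :=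
  (toPoly_mul_le L M _ le_rfl).2

instance : Nontrivial (DiffOp F) := inferInstanceAs (Nontrivial (RatFunc F)[X])

theorem toPoly_ne_zero {L : DiffOp F} (hL : L ≠ 0) : toPoly L ≠ 0 := by
  simpa using hL

instance : NoZeroDivisors (DiffOp F) where
  eq_zero_or_eq_zero_of_mul_eq_zero {L M} h := by
    by_contra! hLM
    have := leadingCoeff_mul L M
    rw [h, map_zero, coeff_zero, eq_comm, mul_eq_zero, leadingCoeff_eq_zero,
      leadingCoeff_eq_zero] at this
    exact this.elim (toPoly_ne_zero hLM.1) (toPoly_ne_zero hLM.2)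

instance : IsDomain (DiffOp F) := NoZeroDivisors.to_isDomain _

theorem ord_mul {L M : DiffOp F} (hL : L ≠ 0) (hM : M ≠ 0) : (L * M).ord = L.ord + M.ord := by
  refine le_antisymm (toPoly_mul_le L M _ le_rfl).1 (le_natDegree_of_ne_zero ?_)
  rw [leadingCoeff_mul]
  exact mul_ne_zero (leadingCoeff_ne_zero.2 (toPoly_ne_zero hL))
    (leadingCoeff_ne_zero.2 (toPoly_ne_zero hM))

theorem Monic.ne_zero {L : DiffOp F} (hL : L.Monic) : L ≠ 0 := by
  rintro rfl
  exact Polynomial.Monic.ne_zero hL (map_zero _)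

theorem Monic.of_mul {L M : DiffOp F} (hM : M.Monic) (h : (L * M).Monic) : L.Monic := by
  have hL : L ≠ 0 := by
    rintro rfl
    exact h.ne_zero (zero_mul _)
  have := leadingCoeff_mul L M
  rw [← ord_mul hL hM.ne_zero, show (toPoly M).leadingCoeff = 1 from hM, mul_one] at this
  exact this.symm.trans h

theorem ord_one : (1 : DiffOp F).ord = 0 := natDegree_one

theorem monic_one : (1 : DiffOp F).Monic := Polynomial.monic_one

theorem ord_coeff (f : RatFunc F) : (coeff f).ord = 0 := natDegree_C f

theorem mem_range_coeff_iff {L : DiffOp F} : L ∈ Set.range (coeff (F := F)) ↔ L.ord = 0 := by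
  constructor
  · rintro ⟨f, rfl⟩
    exact ord_coeff f
  · intro h
    exact ⟨(toPoly L).coeff 0, toPoly.injective (eq_C_of_natDegree_eq_zero h).symm⟩

theorem Monic.eq_one {L : DiffOp F} (hL : L.Monic) (h : L.ord = 0) : L = 1 :=
  toPoly.injective (eq_one_of_monic_natDegree_zero hL h)

theorem isUnit_iff {L : DiffOp F} (hL : L ≠ 0) : IsUnit L ↔ L.ord = 0 := by
  constructor
  · rintro ⟨u, rfl⟩
    have := ord_mul u.ne_zero u⁻¹.ne_zero
    rw [Units.mul_inv, ord_one] at this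
    omega
  · intro h
    obtain ⟨f, rfl⟩ := mem_range_coeff_iff.2 h
    refine IsUnit.map _ (isUnit_iff_ne_zero.2 ?_)
    rintro rfl
    exact hL (map_zero _)

/-- Euclidean division on the right by a nonzero operator. -/
theorem exists_div {B : DiffOp F} (hB : B ≠ 0) (A : DiffOp F) :
    ∃ Q R : DiffOp F, A = Q * B + R ∧ (toPoly R).degree < (toPoly B).degree := by
  induction hn : (toPoly A).degree using WellFoundedLT.induction generalizing A with
  | ind d ih =>
    by_cases hd : (toPoly A).degree < (toPoly B).degree
    · exact ⟨0, A, by simp, hd⟩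
    have hB' := toPoly_ne_zero hB
    have hA : A ≠ 0 := by
      rintro rfl
      exact hd (by simpa [bot_lt_iff_ne_bot] using hB)
    have hle : B.ord ≤ A.ord := natDegree_le_natDegree (not_lt.1 hd)
    set c := (toPoly A).leadingCoeff / (toPoly B).leadingCoeff with hc
    set T : DiffOp F := coeff c * (del ^ (A.ord - B.ord) * B) with hT
    have h1 := toPoly_del_pow_mul_le (A.ord - B.ord) B B.ord le_rfl
    rw [Nat.sub_add_cancel hle] at h1
    have hlt : (toPoly (A - T)).degree < d := by
      rw [← hn, map_sub, hT, toPoly_coeff_mul]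
      refine (degree_lt_iff_coeff_zero _ _).2 ?_ |>.trans_eq
        (degree_eq_natDegree (toPoly_ne_zero hA)).symm
      intro m hm
      rcases hm.lt_or_eq with hm | rfl
      · rw [coeff_sub, coeff_C_mul, coeff_eq_zero_of_natDegree_lt hm,
          coeff_eq_zero_of_natDegree_lt (h1.1.trans_lt hm), mul_zero, sub_zero]
      · have h2 : (toPoly (del ^ (A.ord - B.ord) * B)).coeff (toPoly A).natDegree =
          (toPoly B).leadingCoeff := h1.2
        rw [coeff_sub, coeff_C_mul, h2, coeff_natDegree, hc,
          div_mul_cancel₀ _ (leadingCoeff_ne_zero.2 hB'), sub_self]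
    obtain ⟨Q, R, h, hR⟩ := ih _ hlt (A - T) rfl
    refine ⟨Q + coeff c * del ^ (A.ord - B.ord), R, ?_, hR⟩
    rw [sub_eq_iff_eq_add] at h
    exact h.trans (by rw [hT, add_mul, mul_assoc, add_right_comm])

theorem mem_leftIdeal {A B : DiffOp F} : A ∈ leftIdeal B ↔ ∃ Q, A = Q * B := by
  rw [Submodule.mem_span_singleton]
  simp only [smul_eq_mul, eq_comm]

theorem leftIdeal_le_iff {A : DiffOp F} {I : Submodule (DiffOp F) (DiffOp F)} :
    leftIdeal A ≤ I ↔ A ∈ I := by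
  rw [Submodule.span_singleton_le_iff_mem]

theorem exists_monic_of_ne_zero {B : DiffOp F} (hB : B ≠ 0) :
    ∃ A : DiffOp F, A.Monic ∧ leftIdeal A = leftIdeal B ∧ A.ord = B.ord := by
  have hl := leadingCoeff_ne_zero.2 (toPoly_ne_zero hB)
  have hu : IsUnit (coeff (F := F) (toPoly B).leadingCoeff⁻¹) :=
    IsUnit.map _ (isUnit_iff_ne_zero.2 (inv_ne_zero hl))
  refine ⟨coeff (toPoly B).leadingCoeff⁻¹ * B, ?_, ?_, ?_⟩
  · change (toPoly _).Monic
    rw [toPoly_coeff_mul, mul_comm]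
    exact monic_mul_leadingCoeff_inv (toPoly_ne_zero hB)
  · obtain ⟨u, hu⟩ := hu
    rw [← hu]
    exact Submodule.span_singleton_group_smul_eq _ u B
  · rw [ord_mul hu.ne_zero hB, ord_coeff, zero_add]

/-- Every left ideal of `F(t)⟨∂⟩` is principal. -/
theorem exists_generator (I : Submodule (DiffOp F) (DiffOp F)) : ∃ B, I = leftIdeal B := by
  by_cases hI : ∃ A ∈ I, A ≠ 0
  · obtain ⟨A, hA, hmin⟩ := WellFounded.has_min
      (InvImage.wf (fun A : DiffOp F => A.ord) Nat.lt_wfRel.wf) {A | A ∈ I ∧ A ≠ 0} hI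
    refine ⟨A, le_antisymm (fun M hM => ?_) (leftIdeal_le_iff.2 hA.1)⟩
    obtain ⟨Q, R, h, hR⟩ := exists_div hA.2 M
    refine mem_leftIdeal.2 ⟨Q, ?_⟩
    suffices R = 0 by rw [h, this, add_zero]
    by_contra hR0
    refine hmin R ⟨?_, hR0⟩ (natDegree_lt_natDegree (toPoly_ne_zero hR0) hR)
    rw [← sub_eq_iff_eq_add'.2 h]
    exact I.sub_mem hM (I.smul_mem Q hA.1)
  · push Not at hI
    refine ⟨0, ?_⟩
    rw [leftIdeal, Submodule.span_singleton_eq_bot.2 rfl, eq_bot_iff]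
    exact fun A hA => hI A hA

theorem exists_monic_generator {I : Submodule (DiffOp F) (DiffOp F)} (hI : I ≠ ⊥) :
    ∃ B : DiffOp F, B.Monic ∧ I = leftIdeal B := by
  obtain ⟨B, rfl⟩ := exists_generator I
  obtain ⟨A, hA, h, -⟩ := exists_monic_of_ne_zero (B := B) (by
    rintro rfl
    exact hI (Submodule.span_singleton_eq_bot.2 rfl))
  exact ⟨A, hA, h.symm⟩

theorem leftIdeal_eq_top_iff {B : DiffOp F} (hB : B ≠ 0) : leftIdeal B = ⊤ ↔ B.ord = 0 := by
  constructor
  · intro h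
    obtain ⟨Q, hQ⟩ := mem_leftIdeal.1 (h ▸ Submodule.mem_top : (1 : DiffOp F) ∈ leftIdeal B)
    have hQ0 : Q ≠ 0 := by
      rintro rfl
      simp at hQ
    have := ord_mul hQ0 hB
    rw [← hQ, ord_one] at this
    omega
  · intro h
    obtain ⟨u, rfl⟩ := (isUnit_iff hB).2 h
    exact (Submodule.eq_top_iff').2 fun A => mem_leftIdeal.2 ⟨A * ↑u⁻¹, by simp [mul_assoc]⟩

/-- Operators of order less than that of `L` represent the elements of `𝒟_L`. -/
def quotEquiv {L : DiffOp F} (hL : L ≠ 0) : degreeLT (RatFunc F) L.ord ≃ₗ[RatFunc F] QuotModule L :=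
  LinearEquiv.ofBijective
    { toFun := fun P => (leftIdeal L).mkQ (toPoly.symm P.1)
      map_add' := fun P Q => by simp
      map_smul' := fun f P => by
        have : toPoly.symm ((f • P : degreeLT (RatFunc F) L.ord) : (RatFunc F)[X]) =
            f • toPoly.symm P.1 := toPoly.injective (by simp [toPoly_smul])
        rw [this]
        rfl } <| by
    have hdeg : (toPoly L).degree = L.ord := degree_eq_natDegree (toPoly_ne_zero hL)
    constructor
    · intro P Q h
      have h' : (leftIdeal L).mkQ (toPoly.symm P.1) = (leftIdeal L).mkQ (toPoly.symm Q.1) := h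
      rw [← sub_eq_zero, ← map_sub, Submodule.mkQ_apply, Submodule.Quotient.mk_eq_zero,
        mem_leftIdeal] at h'
      obtain ⟨A, hA⟩ := h'
      have hlt := mem_degreeLT.1 (P - Q).2
      rw [← map_sub] at hA
      by_contra hne
      have hne' : (P - Q).1 ≠ 0 := fun h0 => hne (sub_eq_zero.1 (Subtype.ext h0))
      have hA' : toPoly (A * L) = (P - Q).1 := by rw [← hA]; simp
      have hA0 : A ≠ 0 := by
        rintro rfl
        rw [zero_mul, map_zero] at hA'
        exact hne' hA'.symm
      rw [← hA', degree_eq_natDegree (hA' ▸ hne'), Nat.cast_lt] at hlt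
      have := ord_mul hA0 hL
      unfold ord at *
      omega
    · intro x
      obtain ⟨A, rfl⟩ := (leftIdeal L).mkQ_surjective x
      obtain ⟨Q, R, h, hR⟩ := exists_div hL A
      refine ⟨⟨toPoly R, mem_degreeLT.2 (hdeg ▸ hR)⟩, ?_⟩
      change (leftIdeal L).mkQ (toPoly.symm (toPoly R)) = _
      rw [AddEquiv.symm_apply_apply, ← sub_eq_zero, ← map_sub, Submodule.mkQ_apply,
        Submodule.Quotient.mk_eq_zero]
      exact mem_leftIdeal.2 ⟨-Q, by rw [h]; simp⟩

theorem finite_quotModule {L : DiffOp F} (hL : L ≠ 0) :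
    Module.Finite (RatFunc F) (QuotModule L) :=
  Module.Finite.equiv (degreeLTEquiv (RatFunc F) L.ord |>.symm.trans (quotEquiv hL))

theorem finrank_quotModule {L : DiffOp F} (hL : L ≠ 0) :
    Module.finrank (RatFunc F) (QuotModule L) = L.ord := by
  rw [← (degreeLTEquiv (RatFunc F) L.ord |>.symm.trans (quotEquiv hL)).finrank_eq]
  simp

end Euclidean

/-! ### Constants and polynomials in `∂ ^ p` -/

section Char

theorem charP_ratFunc {F : Type*} [Field F] (p : ℕ) [CharP F p] : CharP (RatFunc F) p :=
  charP_of_injective_algebraMap (algebraMap F (RatFunc F)).injective p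

variable {F : Type*} [Field F] (p : ℕ) [hp : Fact p.Prime] [hchar : CharP F p]

theorem charP_diffOp : CharP (DiffOp F) p :=
  have := charP_ratFunc (F := F) p
  charP_of_injective_ringHom (coeff (F := F)).injective p

theorem ddt_pow_char (f : RatFunc F) : ddt (f ^ p) = 0 := by
  have := charP_ratFunc (F := F) p
  rw [Derivation.leibniz_pow, ← Nat.cast_smul_eq_nsmul (RatFunc F), CharP.cast_eq_zero, zero_smul]

theorem ddt_X : ddt (RatFunc.X : RatFunc F) = 1 := by
  rw [← RatFunc.algebraMap_X, ddt_algebraMap, derivative_X, map_one]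

theorem algebraMap_mem_constField {a : F[X]} (ha : derivative a = 0) :
    algebraMap F[X] (RatFunc F) a ∈ ConstField F p := by
  rw [← expand_contract p ha hp.out.ne_zero]
  induction contract p a using Polynomial.induction_on' with
  | add a b ha hb => rw [map_add, map_add]; exact add_mem ha hb
  | monomial i c =>
    rw [expand_monomial, ← C_mul_X_pow_eq_monomial, map_mul, map_pow, RatFunc.algebraMap_X,
      RatFunc.algebraMap_C, mul_comm i, pow_mul]
    exact mul_mem (IntermediateField.algebraMap_mem _ c)
      (pow_mem (IntermediateField.mem_adjoin_simple_self F _) i)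

theorem mul_denom_pow (f : RatFunc F) : f * algebraMap F[X] (RatFunc F) (f.denom ^ p) =
    algebraMap F[X] (RatFunc F) (f.num * f.denom ^ (p - 1)) := by
  have hd : algebraMap F[X] (RatFunc F) f.denom ≠ 0 := by simpa using f.denom_ne_zero
  have h : f * algebraMap F[X] (RatFunc F) f.denom = algebraMap F[X] (RatFunc F) f.num := by
    rw [← eq_div_iff hd, f.num_div_denom]
  rw [← mul_pow_sub_one hp.out.ne_zero, map_mul, ← mul_assoc, h, ← map_mul]

theorem derivative_pow_char (b : F[X]) : derivative (b ^ p) = 0 := by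
  rw [derivative_pow, CharP.cast_eq_zero F p]
  simp

/-- The constants of `F(t)` are the elements of `F(t ^ p)`: if `f' = 0`, then `f = a / b ^ p` with
`b` the denominator of `f`, and both polynomials `a` and `b ^ p` have derivative zero. -/
theorem ddt_eq_zero_iff {f : RatFunc F} : ddt f = 0 ↔ f ∈ ConstField F p := by
  constructor
  · intro h
    have hd : algebraMap F[X] (RatFunc F) f.denom ≠ 0 := by simpa using f.denom_ne_zero
    set a := f.num * f.denom ^ (p - 1) with ha
    have hf := (mul_denom_pow p f).symm
    have h1 := derivative_pow_char p f.denom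
    have h2 : derivative a = 0 := by
      apply RatFunc.algebraMap_injective F
      rw [← ddt_algebraMap, hf, Derivation.leibniz, h, ddt_algebraMap, h1]
      simp
    rw [(eq_div_iff (by rw [map_pow]; exact pow_ne_zero _ hd)).2 hf.symm]
    exact div_mem (algebraMap_mem_constField p h2) (algebraMap_mem_constField p h1)
  · intro h
    induction h using IntermediateField.adjoin_induction with
    | mem x hx =>
      rw [Set.mem_singleton_iff.1 hx, ddt_pow_char p]
    | algebraMap c => exact Derivation.map_algebraMap _ c
    | add x y _ _ hx hy => rw [map_add, hx, hy, add_zero]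
    | mul x y _ _ hx hy => rw [Derivation.leibniz, hx, hy, smul_zero, smul_zero, add_zero]
    | inv x _ hx => rw [Derivation.leibniz_inv, hx, smul_zero]

/-- The powers `1, t, …, t ^ (p - 1)` span `F(t)` over the field of constants. -/
theorem exists_sum_X_pow (f : RatFunc F) :
    ∃ c : ℕ → ConstField F p, f = ∑ i ∈ Finset.range p, RatFunc.X ^ i * (c i : RatFunc F) := by
  let S : Submodule (ConstField F p) (RatFunc F) :=
    { carrier := {f | ∃ c : ℕ → ConstField F p,
        f = ∑ i ∈ Finset.range p, RatFunc.X ^ i * (c i : RatFunc F)}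
      zero_mem' := ⟨0, by simp⟩
      add_mem' := by
        rintro _ _ ⟨c, rfl⟩ ⟨d, rfl⟩
        exact ⟨c + d, by simp [mul_add, Finset.sum_add_distrib]⟩
      smul_mem' := by
        rintro a _ ⟨c, rfl⟩
        refine ⟨a • c, ?_⟩
        rw [Algebra.smul_def, Finset.mul_sum]
        exact Finset.sum_congr rfl fun i _ => by
          rw [mul_left_comm]
          rfl }
  have hpoly : ∀ a : F[X], algebraMap F[X] (RatFunc F) a ∈ S := by
    intro a
    induction a using Polynomial.induction_on' with
    | add a b ha hb =>
      rw [map_add]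
      exact S.add_mem ha hb
    | monomial n c =>
      have hX : (RatFunc.X : RatFunc F) ^ (n % p) ∈ S :=
        ⟨Pi.single (n % p) 1, by
          rw [Finset.sum_eq_single (n % p)]
          · simp
          · intro j _ hj
            simp [hj]
          · intro h
            exact absurd (Finset.mem_range.2 (Nat.mod_lt _ hp.out.pos)) h⟩
      have hc : algebraMap F (RatFunc F) c * (RatFunc.X ^ p) ^ (n / p) ∈ ConstField F p :=
        mul_mem (IntermediateField.algebraMap_mem _ c)
          (pow_mem (IntermediateField.mem_adjoin_simple_self F _) _)
      convert S.smul_mem ⟨_, hc⟩ hX using 1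
      rw [Algebra.smul_def, ← C_mul_X_pow_eq_monomial, map_mul, map_pow, RatFunc.algebraMap_X,
        RatFunc.algebraMap_C]
      conv_lhs => rw [← Nat.div_add_mod n p, pow_add, pow_mul, ← mul_assoc]
      rfl
  have hd : algebraMap F[X] (RatFunc F) (f.denom ^ p) ≠ 0 := by
    simp [f.denom_ne_zero]
  have := S.smul_mem ⟨_, inv_mem (algebraMap_mem_constField p (derivative_pow_char p f.denom))⟩
    (hpoly (f.num * f.denom ^ (p - 1)))
  rw [← mul_denom_pow, Algebra.smul_def] at this
  change (algebraMap F[X] (RatFunc F) (f.denom ^ p))⁻¹ * _ ∈ S at this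
  rwa [mul_comm f, inv_mul_cancel_left₀ hd] at this

theorem toPoly_del_pow (i : ℕ) : toPoly ((del : DiffOp F) ^ i) = X ^ i := by
  induction i with
  | zero => simp [toPoly_one]
  | succ n ih =>
    rw [pow_succ', toPoly_del_mul, ih, ← monomial_one_right_eq_X_pow, ddtCoeff_monomial,
      Derivation.map_one_eq_zero, map_zero, add_zero, monomial_one_right_eq_X_pow, ← pow_succ']

/-- The ring homomorphism `Q ↦ Q(∂ ^ p)` from `F(t)[Y]` to `F(t)⟨∂⟩`; it exists because `∂ ^ p`
commutes with the elements of `F(t)`. -/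
def evalDel : (RatFunc F)[X] →+* DiffOp F :=
  eval₂RingHom' coeff (del ^ p) fun f => (del_pow_mul_coeff p f).symm

theorem evalDel_C (f : RatFunc F) : evalDel p (C f) = coeff f := eval₂_C _ _

theorem evalDel_X : evalDel p (X : (RatFunc F)[X]) = del ^ p := eval₂_X _ _

theorem evalDelPow_eq (N : (ConstField F p)[X]) :
    evalDelPow p N = evalDel p (N.map (algebraMap (ConstField F p) (RatFunc F))) :=
  (eval₂_map _ _ _).symm

theorem evalDel_monomial (i : ℕ) (f : RatFunc F) :
    evalDel p (monomial i f) = coeff f * del ^ (p * i) := by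
  rw [pow_mul]
  exact eval₂_monomial _ _

theorem toPoly_evalDel (a : (RatFunc F)[X]) : toPoly (evalDel p a) = expand _ p a := by
  induction a using Polynomial.induction_on' with
  | add a b ha hb => rw [map_add, map_add, map_add, ha, hb]
  | monomial i f =>
    rw [evalDel_monomial, toPoly_coeff_mul, toPoly_del_pow, expand_monomial,
      C_mul_X_pow_eq_monomial, mul_comm]

theorem evalDel_injective : Function.Injective (evalDel (F := F) p) := fun a b h =>
  expand_injective hp.out.pos (by rw [← toPoly_evalDel, ← toPoly_evalDel, h])

theorem ord_evalDel (a : (RatFunc F)[X]) : (evalDel p a).ord = a.natDegree * p := by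
  rw [ord, toPoly_evalDel, natDegree_expand]

theorem monic_evalDel {a : (RatFunc F)[X]} (ha : a.Monic) : (evalDel p a).Monic := by
  rw [Monic, toPoly_evalDel]
  exact ha.expand hp.out.pos

theorem del_mul_evalDel (a : (RatFunc F)[X]) :
    del * evalDel p a = evalDel p a * del + evalDel p (ddtCoeff a) := by
  induction a using Polynomial.induction_on' with
  | add a b ha hb =>
    rw [map_add, map_add, map_add, mul_add, add_mul, ha, hb, add_add_add_comm]
  | monomial i f =>
    rw [ddtCoeff_monomial, evalDel_monomial, evalDel_monomial, ← mul_assoc, del_mul_coeff, add_mul,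
      mul_assoc, mul_assoc, ← pow_succ', ← pow_succ]

theorem ddtCoeff_mul (a b : (RatFunc F)[X]) :
    ddtCoeff (a * b) = a * ddtCoeff b + ddtCoeff a * b := by
  induction a using Polynomial.induction_on' with
  | add a a' ha ha' => rw [add_mul, map_add, ha, ha', map_add]; ring
  | monomial i f =>
    induction b using Polynomial.induction_on' with
    | add b b' hb hb' => rw [mul_add, map_add, hb, hb', map_add]; ring
    | monomial j g =>
      simp only [ddtCoeff_monomial, monomial_mul_monomial, Derivation.leibniz, smul_eq_mul, map_add]
      rw [mul_comm g]

theorem ddtCoeff_C (f : RatFunc F) : ddtCoeff (C f) = C (ddt f) := ddtCoeff_monomial 0 f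

theorem ddtCoeff_map (a : (ConstField F p)[X]) :
    ddtCoeff (a.map (algebraMap (ConstField F p) (RatFunc F))) = 0 := by
  ext i
  rw [ddtCoeff_coeff, coeff_map, coeff_zero, ddt_eq_zero_iff p]
  exact (a.coeff i).2

theorem exists_map_of_ddtCoeff_eq_zero {a : (RatFunc F)[X]} (ha : ddtCoeff a = 0) :
    ∃ b : (ConstField F p)[X], b.map (algebraMap (ConstField F p) (RatFunc F)) = a := by
  rw [← mem_lifts, lifts_iff_coeff_lifts]
  intro n
  refine ⟨⟨a.coeff n, (ddt_eq_zero_iff p).1 ?_⟩, rfl⟩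
  rw [← ddtCoeff_coeff, ha, coeff_zero]

theorem ddtCoeff_mul_of_const {a : (RatFunc F)[X]} (ha : ddtCoeff a = 0) (b : (RatFunc F)[X]) :
    ddtCoeff (a * b) = a * ddtCoeff b := by
  rw [ddtCoeff_mul, ha, zero_mul, add_zero]

theorem ddtCoeff_pow_of_const {a : (RatFunc F)[X]} (ha : ddtCoeff a = 0) (n : ℕ) :
    ddtCoeff (a ^ n) = 0 := by
  induction n with
  | zero => rw [pow_zero, ← C_1, ddtCoeff_C, Derivation.map_one_eq_zero, map_zero]
  | succ n ih => rw [pow_succ, ddtCoeff_mul_of_const ih, ha, mul_zero]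

/-- Polynomials in `∂ ^ p` with constant coefficients are central. -/
theorem commute_evalDel {a : (RatFunc F)[X]} (ha : ddtCoeff a = 0) (L : DiffOp F) :
    Commute (evalDel p a) L := by
  have hdel : Commute (evalDel p a) del := by
    have := del_mul_evalDel p a
    rw [ha, map_zero, add_zero] at this
    exact this.symm
  rw [eq_sum L, Polynomial.sum_def]
  refine Commute.sum_right _ _ _ fun i _ => Commute.mul_right ?_ (hdel.pow_right _)
  rw [← evalDel_C p]
  exact (Commute.all a _).map (evalDel p)

/-- Commutation with `t` differentiates an operator formally with respect to `∂`. -/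
theorem toPoly_mul_X_sub (L : DiffOp F) :
    toPoly (L * coeff RatFunc.X - coeff RatFunc.X * L) = derivative (toPoly L) := by
  have h : ∀ n : ℕ, (del : DiffOp F) ^ n * coeff RatFunc.X =
      coeff RatFunc.X * del ^ n + (n : DiffOp F) * del ^ (n - 1) := by
    intro n
    induction n with
    | zero => simp
    | succ n ih =>
      rw [pow_succ', mul_assoc, ih, mul_add, ← mul_assoc, del_mul_coeff, ddt_X, map_one, add_mul,
        one_mul, mul_assoc, ← pow_succ', ← mul_assoc, (Nat.cast_commute n (del : DiffOp F)).symm.eq,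
        mul_assoc, Nat.cast_succ, add_mul, one_mul, Nat.succ_sub_one, add_assoc]
      congr 1
      rcases n with _ | n
      · simp
      · rw [Nat.succ_sub_one, ← pow_succ', add_comm]
  obtain ⟨P, rfl⟩ := toPoly.symm.surjective L
  rw [AddEquiv.apply_symm_apply]
  induction P using Polynomial.induction_on' with
  | add P Q hP hQ =>
    rw [map_add, add_mul, mul_add, add_sub_add_comm, map_add, hP, hQ, map_add]
  | monomial n f =>
    have h1 : toPoly.symm (monomial n f) = coeff f * del ^ n := toPoly.injective <| by
      rw [toPoly_coeff_mul, toPoly_del_pow, C_mul_X_pow_eq_monomial, AddEquiv.apply_symm_apply]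
    rw [h1, mul_assoc, h, mul_add, ← mul_assoc, ← map_mul, ← mul_assoc (coeff RatFunc.X),
      ← map_mul, mul_comm f RatFunc.X, add_sub_cancel_left, ← map_natCast (coeff (F := F)),
      ← mul_assoc, ← map_mul, toPoly_coeff_mul, toPoly_del_pow, C_mul_X_pow_eq_monomial,
      derivative_monomial]

theorem exists_evalDel_of_commute_X {L : DiffOp F}
    (hL : L * coeff RatFunc.X = coeff RatFunc.X * L) : ∃ a, L = evalDel p a := by
  have := charP_ratFunc (F := F) p
  refine ⟨contract p (toPoly L), toPoly.injective ?_⟩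
  rw [toPoly_evalDel, expand_contract p _ hp.out.ne_zero]
  rw [← toPoly_mul_X_sub, hL, sub_self, map_zero]

/-- An irreducible separable polynomial over the constants remains irreducible over `F(t)`: a monic
factor divides its own derivative with respect to `t`, so it has constant coefficients. -/
theorem irreducible_map {N : (ConstField F p)[X]} (hN_monic : N.Monic) (hN_irr : Irreducible N)
    (hN_sep : N.Separable) :
    Irreducible (N.map (algebraMap (ConstField F p) (RatFunc F))) := by
  have hdvd : ∀ f g : (RatFunc F)[X], f.Monic → IsCoprime f g →
      f * ddtCoeff g + ddtCoeff f * g = 0 → ddtCoeff f = 0 := by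
    intro f g hf hfg h
    have h1 : f ∣ ddtCoeff f := hfg.dvd_of_dvd_mul_right <| by
      rw [eq_neg_of_add_eq_zero_right h]
      exact (dvd_mul_right _ _).neg_right
    refine eq_zero_of_dvd_of_degree_lt h1 ?_
    rw [degree_eq_natDegree hf.ne_zero, degree_lt_iff_coeff_zero]
    intro m hm
    rw [ddtCoeff_coeff]
    rcases (show f.natDegree ≤ m from hm).lt_or_eq with h | rfl
    · rw [coeff_eq_zero_of_natDegree_lt h, map_zero]
    · rw [hf.coeff_natDegree, Derivation.map_one_eq_zero]
  have hM := hN_monic.map (algebraMap (ConstField F p) (RatFunc F))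
  have hM1 : N.map (algebraMap (ConstField F p) (RatFunc F)) ≠ 1 := by
    intro h
    rw [← Polynomial.map_one (algebraMap (ConstField F p) (RatFunc F))] at h
    exact hN_irr.ne_one (map_injective _ (algebraMap (ConstField F p) (RatFunc F)).injective h)
  rw [irreducible_of_monic hM hM1]
  intro f g hf hg hfg
  have hcop : IsCoprime f g := (hfg ▸ hN_sep.map : (f * g).Separable).isCoprime
  have h0 := ddtCoeff_map p N
  rw [← hfg, ddtCoeff_mul] at h0
  obtain ⟨f', rfl⟩ := exists_map_of_ddtCoeff_eq_zero p (hdvd _ g hf hcop h0)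
  obtain ⟨g', rfl⟩ := exists_map_of_ddtCoeff_eq_zero p (hdvd g _ hg hcop.symm (by
    rw [← h0]; ring))
  rw [← Polynomial.map_mul] at hfg
  have hfg' := map_injective _ (algebraMap (ConstField F p) (RatFunc F)).injective hfg
  refine (hN_irr.isUnit_or_isUnit hfg'.symm).imp (fun h => ?_) fun h => ?_
  · exact eq_one_of_monic_natDegree_zero hf (by rw [natDegree_map, natDegree_eq_zero_of_isUnit h])
  · exact eq_one_of_monic_natDegree_zero hg (by rw [natDegree_map, natDegree_eq_zero_of_isUnit h])

end Char

/-! ### Divisors of powers of a central irreducible operator -/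

section CentralIrreducible

variable {F : Type*} [Field F]

theorem Decomposable.exists_leftIdeal {L : DiffOp F} (h : L.Decomposable) :
    ∃ L₁ L₂ : DiffOp F, L₁.ord ≠ 0 ∧ L₂.ord ≠ 0 ∧ leftIdeal L₁ ⊔ leftIdeal L₂ = ⊤ ∧
      leftIdeal L = leftIdeal L₁ ⊓ leftIdeal L₂ := by
  obtain ⟨L₁, L₂, h₁, h₂, hgcd, hlcm⟩ := h
  refine ⟨L₁, L₂, mem_range_coeff_iff.not.1 h₁, mem_range_coeff_iff.not.1 h₂, ?_, ?_⟩
  · rw [← (leftIdeal_eq_top_iff one_ne_zero).2 ord_one]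
    exact hgcd.symm
  · rw [hlcm]
    refine le_antisymm (le_inf (iInf_le _ 0) (iInf_le _ 1)) (le_iInf fun i => ?_)
    fin_cases i
    · exact inf_le_left
    · exact inf_le_right

/-- A left divisor of a central operator is also a right divisor, with the same cofactor. -/
theorem eq_mul_of_eq_mul_comm {c L Q : DiffOp F} (hc : Commute c Q) (hc0 : c ≠ 0)
    (h : c = L * Q) : c = Q * L := by
  have hQ : Q ≠ 0 := by
    rintro rfl
    exact hc0 (by rw [h, mul_zero])
  refine mul_right_cancel₀ hQ ?_
  rw [mul_assoc, ← h, hc.eq]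

/-- By induction on `ν`: a divisor that is not coprime to the irreducible operator `c` is a multiple
of `c`, and one that is coprime to `c` is coprime to `c ^ ν`, hence a unit. -/
theorem exists_unit_mul_pow {c : DiffOp F} (hc : ∀ A, Commute c A) (hirr : Irreducible c) (ν : ℕ)
    {L Q : DiffOp F} (h : c ^ ν = Q * L) :
    ∃ m ≤ ν, ∃ u : DiffOp F, IsUnit u ∧ L = u * c ^ m := by
  have hunit : ∀ {L Q : DiffOp F}, 1 = Q * L → IsUnit L := by
    intro L Q h
    have hL : L ≠ 0 := by
      rintro rfl
      simp at h
    refine (isUnit_iff hL).2 ?_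
    rw [← leftIdeal_eq_top_iff hL, Submodule.eq_top_iff']
    exact fun A => mem_leftIdeal.2 ⟨A * Q, by rw [mul_assoc, ← h, mul_one]⟩
  induction ν generalizing L Q with
  | zero => exact ⟨0, le_rfl, L, hunit (by rwa [pow_zero] at h), by simp⟩
  | succ ν ih =>
    obtain ⟨G, hG⟩ := exists_generator (leftIdeal L ⊔ leftIdeal c)
    have hcG : c ∈ leftIdeal G := hG ▸ Submodule.mem_sup_right (Submodule.mem_span_singleton_self c)
    have hLG : L ∈ leftIdeal G := hG ▸ Submodule.mem_sup_left (Submodule.mem_span_singleton_self L)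
    obtain ⟨A, hA⟩ := mem_leftIdeal.1 hcG
    rcases hirr.isUnit_or_isUnit hA with hu | hu
    · obtain ⟨B, hB⟩ := mem_leftIdeal.1 hLG
      obtain ⟨u, rfl⟩ := hu
      have hLc : L = B * ↑u⁻¹ * c := by rw [hB, hA, mul_assoc, Units.inv_mul_cancel_left]
      rw [hLc, ← mul_assoc, pow_succ] at h
      obtain ⟨m, hm, v, hv, h'⟩ := ih (mul_right_cancel₀ hirr.ne_zero h)
      exact ⟨m + 1, by omega, v, hv, by rw [hLc, h', mul_assoc, pow_succ]⟩
    · have htop : leftIdeal L ⊔ leftIdeal c = ⊤ := by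
        rw [hG, leftIdeal_eq_top_iff hu.ne_zero]
        exact (isUnit_iff hu.ne_zero).1 hu
      -- `𝒟 L + 𝒟 c = 𝒟` implies `𝒟 L + 𝒟 cⁿ = 𝒟` because `c` is central
      have key : ∀ n : ℕ, ∃ X Y : DiffOp F, 1 = X * L + Y * c ^ n := by
        obtain ⟨a, ha, b, hb, hab⟩ :=
          Submodule.mem_sup.1
            (htop ▸ Submodule.mem_top : (1 : DiffOp F) ∈ leftIdeal L ⊔ leftIdeal c)
        obtain ⟨X₁, rfl⟩ := mem_leftIdeal.1 ha
        obtain ⟨Y₁, rfl⟩ := mem_leftIdeal.1 hb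
        intro n
        induction n with
        | zero => exact ⟨0, 1, by simp⟩
        | succ n ihn =>
          obtain ⟨X, Y, hXY⟩ := ihn
          refine ⟨X + Y * c ^ n * X₁, Y * Y₁, ?_⟩
          calc 1 = X * L + Y * c ^ n * 1 := by rw [mul_one]; exact hXY
            _ = X * L + Y * c ^ n * (X₁ * L + Y₁ * c) := by rw [hab]
            _ = _ := by
              rw [mul_add, add_mul, mul_assoc Y (c ^ n) (Y₁ * c), ← mul_assoc (c ^ n) Y₁ c,
                ((hc Y₁).pow_left n).eq, mul_assoc Y₁, ← pow_succ, ← mul_assoc (Y * c ^ n),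
                ← mul_assoc Y Y₁, add_assoc]
      obtain ⟨X, Y, hXY⟩ := key (ν + 1)
      rw [h, ← mul_assoc, ← add_mul] at hXY
      exact ⟨0, Nat.zero_le _, L, hunit hXY, by simp⟩

theorem eq_pow_of_dvd {c : DiffOp F} (hc : ∀ A, Commute c A) (hirr : Irreducible c)
    (hcm : c.Monic) {ν : ℕ} {L Q : DiffOp F} (hL : L.Monic) (h : c ^ ν = Q * L) :
    ∃ m ≤ ν, L = c ^ m := by
  obtain ⟨m, hm, u, hu, rfl⟩ := exists_unit_mul_pow hc hirr ν h
  have hcpow : (c ^ m).Monic := by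
    clear hm hL h
    induction m with
    | zero => exact pow_zero c ▸ monic_one
    | succ m ih =>
      have := leadingCoeff_mul (c ^ m) c
      rw [← ord_mul ih.ne_zero hcm.ne_zero, ← pow_succ, show (toPoly c).leadingCoeff = 1 from hcm,
        show (toPoly (c ^ m)).leadingCoeff = 1 from ih, mul_one] at this
      exact this
  refine ⟨m, hm, ?_⟩
  rw [(Monic.of_mul hcpow hL).eq_one ((isUnit_iff hu.ne_zero).1 hu), one_mul]

/-- Divisors of `c ^ ν` of positive order are all multiples of `c`, so no two are coprime. -/
theorem indecomposable_of_dvd {c : DiffOp F} (hc : ∀ A, Commute c A) (hirr : Irreducible c)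
    {ν : ℕ} {L Q : DiffOp F} (h : c ^ ν = Q * L) : L.Indecomposable := by
  intro hdec
  obtain ⟨L₁, L₂, h₁, h₂, htop, hinf⟩ := hdec.exists_leftIdeal
  have key : ∀ M : DiffOp F, M.ord ≠ 0 → leftIdeal L ≤ leftIdeal M →
      leftIdeal M ≤ leftIdeal c := by
    intro M hM hLM
    obtain ⟨A, hA⟩ := mem_leftIdeal.1 (leftIdeal_le_iff.1 hLM)
    rw [hA, ← mul_assoc] at h
    obtain ⟨m, -, u, hu, rfl⟩ := exists_unit_mul_pow hc hirr ν h
    rcases m with _ | m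
    · rw [pow_zero, mul_one] at hM
      exact absurd ((isUnit_iff hu.ne_zero).1 hu) hM
    · exact leftIdeal_le_iff.2 (mem_leftIdeal.2 ⟨u * c ^ m, by rw [pow_succ, mul_assoc]⟩)
  have : leftIdeal c = ⊤ := top_le_iff.1 <| htop ▸ sup_le
    (key L₁ h₁ (hinf ▸ inf_le_left)) (key L₂ h₂ (hinf ▸ inf_le_right))
  rw [leftIdeal_eq_top_iff hirr.ne_zero, ← isUnit_iff hirr.ne_zero] at this
  exact hirr.not_isUnit this

end CentralIrreducible

/-! ### Simple modules killed by a central irreducible polynomial -/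

section Simple

variable {F : Type*} [Field F] (p : ℕ) [hp : Fact p.Prime] [hchar : CharP F p]

theorem mem_leftIdeal_iff_of_degree_lt {A B : DiffOp F}
    (h : (toPoly A).degree < (toPoly B).degree) :
    A ∈ leftIdeal B ↔ A = 0 := by
  refine ⟨fun hA => ?_, fun hA => hA ▸ zero_mem _⟩
  obtain ⟨Q, rfl⟩ := mem_leftIdeal.1 hA
  by_contra h0
  have hQ : Q ≠ 0 := left_ne_zero_of_mul h0
  have hB : B ≠ 0 := right_ne_zero_of_mul h0
  have h1 := natDegree_lt_natDegree (toPoly_ne_zero h0) h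
  have h2 := ord_mul hQ hB
  unfold ord at h2
  omega

theorem dvd_of_evalDel_mem {a b : (RatFunc F)[X]} (ha : a ≠ 0)
    (h : evalDel p b ∈ leftIdeal (evalDel p a)) : a ∣ b := by
  rw [← EuclideanDomain.mod_eq_zero]
  refine evalDel_injective p ?_
  rw [map_zero, ← mem_leftIdeal_iff_of_degree_lt (B := evalDel p a)]
  · rw [EuclideanDomain.mod_eq_sub_mul_div, map_sub, mul_comm, map_mul]
    exact sub_mem h (mem_leftIdeal.2 ⟨_, rfl⟩)
  · have h1 : (b % a).degree < a.degree := degree_mod_lt b ha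
    rw [toPoly_evalDel, toPoly_evalDel]
    rcases eq_or_ne (b % a) 0 with h0 | h0
    · rw [h0, map_zero, degree_zero, bot_lt_iff_ne_bot, Ne, degree_eq_bot,
        expand_eq_zero hp.out.pos]
      exact ha
    · refine degree_lt_degree ?_
      rw [natDegree_expand, natDegree_expand]
      exact Nat.mul_lt_mul_of_pos_right (natDegree_lt_natDegree h0 h1) hp.out.pos

/-- If `N` is irreducible over `F(t)`, then `𝒟` is the only two-sided ideal strictly larger than
`𝒟 N(∂ ^ p)`. The monic generator of such an ideal commutes with `t`, since its commutator with `t`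
lies in the ideal and has smaller order; hence it is a polynomial in `∂ ^ p`, and a factor
of `N`. -/
theorem eq_top_of_two_sided {N : (RatFunc F)[X]} (hN : Irreducible N)
    {I : Submodule (DiffOp F) (DiffOp F)} (hI : ∀ A ∈ I, ∀ B, A * B ∈ I)
    (hlt : leftIdeal (evalDel p N) < I) : I = ⊤ := by
  obtain ⟨L, hL, rfl⟩ := exists_monic_generator (ne_bot_of_gt hlt)
  have hLI : L ∈ leftIdeal L := Submodule.mem_span_singleton_self L
  have hcomm : L * coeff RatFunc.X - coeff RatFunc.X * L = 0 := by
    rw [← mem_leftIdeal_iff_of_degree_lt (B := L)]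
    · exact sub_mem (hI L hLI _) (Submodule.smul_mem _ (coeff RatFunc.X) hLI)
    · rw [toPoly_mul_X_sub]
      exact degree_derivative_lt (toPoly_ne_zero hL.ne_zero)
  obtain ⟨a, rfl⟩ := exists_evalDel_of_commute_X p (sub_eq_zero.1 hcomm)
  have ha : a ≠ 0 := by
    rintro rfl
    exact hL.ne_zero (map_zero _)
  obtain ⟨b, hb⟩ := dvd_of_evalDel_mem p ha (leftIdeal_le_iff.1 hlt.le)
  rcases hN.isUnit_or_isUnit hb with hu | hu
  · rw [leftIdeal_eq_top_iff hL.ne_zero, ord_evalDel, natDegree_eq_zero_of_isUnit hu, zero_mul]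
  · refine absurd hlt.not_ge (not_not.2 (leftIdeal_le_iff.2 ?_))
    obtain ⟨u, rfl⟩ := hu
    refine mem_leftIdeal.2 ⟨evalDel p ↑u⁻¹, ?_⟩
    rw [hb, ← map_mul, mul_comm, mul_assoc, Units.mul_inv, mul_one]

theorem coeff_smul {V : Type*} [AddCommGroup V] [Module (DiffOp F) V] [Module (RatFunc F) V]
    [IsScalarTower (RatFunc F) (DiffOp F) V] (f : RatFunc F) (v : V) : coeff f • v = f • v := by
  rw [← mul_one (coeff f), ← smul_def, smul_assoc, one_smul]

/-- A module killed by `N(∂ ^ p)` is a vector space over the field `F(t)[Y]/(N)`, so its dimension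
over `F(t)` is a multiple of the degree of `N`. -/
theorem finrank_eq_natDegree_mul {N : (RatFunc F)[X]} (hN : Irreducible N) {V : Type*}
    [AddCommGroup V] [Module (DiffOp F) V] [Module (RatFunc F) V]
    [IsScalarTower (RatFunc F) (DiffOp F) V] (hV : ∀ v : V, evalDel p N • v = 0) :
    ∃ r, Module.finrank (RatFunc F) V = N.natDegree * r ∧
      (r = 1 → ∀ v : V, v ≠ 0 → ∀ w : V, ∃ a : (RatFunc F)[X], w = evalDel p a • v) := by
  have : Fact (Irreducible N) := ⟨hN⟩
  let φ : (RatFunc F)[X] →+* AddMonoid.End V :=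
    (Module.toAddMonoidEnd (DiffOp F) V).comp (evalDel p)
  let ψ : AdjoinRoot N →+* AddMonoid.End V := Ideal.Quotient.lift (Ideal.span {N}) φ <| by
    intro a ha
    obtain ⟨b, rfl⟩ := Ideal.mem_span_singleton'.1 ha
    ext v
    change evalDel p (b * N) • v = 0
    rw [map_mul, mul_smul, hV, smul_zero]
  let : Module (AdjoinRoot N) V := Module.compHom V ψ
  have hsmul : ∀ (a : (RatFunc F)[X]) (v : V), AdjoinRoot.mk N a • v = evalDel p a • v :=
    fun a v => rfl
  have : IsScalarTower (RatFunc F) (AdjoinRoot N) V := ⟨fun f a v => by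
    obtain ⟨a, rfl⟩ := AdjoinRoot.mk_surjective a
    rw [Algebra.smul_def, AdjoinRoot.algebraMap_eq, ← AdjoinRoot.mk_C, ← map_mul, hsmul, hsmul,
      map_mul, mul_smul, evalDel_C, coeff_smul]⟩
  refine ⟨Module.finrank (AdjoinRoot N) V, ?_, fun hr v hv w => ?_⟩
  · rw [← Module.finrank_mul_finrank (RatFunc F) (AdjoinRoot N) V,
      (AdjoinRoot.powerBasis hN.ne_zero).finrank, AdjoinRoot.powerBasis_dim]
  · obtain ⟨c, rfl⟩ := (finrank_eq_one_iff_of_nonzero' v hv).1 hr w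
    obtain ⟨a, rfl⟩ := AdjoinRoot.mk_surjective c
    exact ⟨a, hsmul a v⟩

/-- If `N(∂ ^ p)` is central and reducible, then some module killed by it has rank one over
`F(t)[Y]/(N)`: the module `𝒟 / 𝒟 N(∂ ^ p)` has rank `p` and is a direct sum of copies of one simple
module, the isotypic component being a two-sided ideal. As `p` is prime and there is more than one
copy, the simple module has rank one. -/
theorem exists_del_smul_eq {N : (RatFunc F)[X]} (hN : Irreducible N) (hδ : ddtCoeff N = 0)
    (hred : ¬ Irreducible (evalDel p N)) :
    ∃ (s : QuotModule (evalDel p N)) (f : (RatFunc F)[X]), s ≠ 0 ∧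
      (del : DiffOp F) • s = evalDel p f • s := by
  set c := evalDel p N with hc
  have hcomm : ∀ A, Commute c A := commute_evalDel p hδ
  have hc0 : c ≠ 0 := fun h => hN.ne_zero (evalDel_injective p (h.trans (map_zero _).symm))
  have hdeg : N.natDegree ≠ 0 := hN.natDegree_pos.ne'
  have hord : c.ord = N.natDegree * p := ord_evalDel p N
  have hcunit : ¬ IsUnit c := by
    rw [isUnit_iff hc0, hord]
    exact mul_ne_zero hdeg hp.out.ne_zero
  have hkill : ∀ x : QuotModule c, c • x = 0 := by
    intro x
    obtain ⟨A, rfl⟩ := (leftIdeal c).mkQ_surjective x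
    rw [← map_smul, Submodule.mkQ_apply, Submodule.Quotient.mk_eq_zero, smul_eq_mul, (hcomm A).eq]
    exact mem_leftIdeal.2 ⟨A, rfl⟩
  have := finite_quotModule hc0
  have : Nontrivial (QuotModule c) := by
    rw [Submodule.Quotient.nontrivial_iff, Ne, leftIdeal_eq_top_iff hc0, ← isUnit_iff hc0]
    exact hcunit
  have : IsArtinian (DiffOp F) (QuotModule c) := isArtinian_of_tower (RatFunc F) inferInstance
  obtain ⟨S, hS⟩ := IsAtomic.exists_atom (Submodule (DiffOp F) (QuotModule c))
  rw [← isSimpleModule_iff_isAtom] at hS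
  -- the isotypic component of `S` is everything, since its preimage is a two-sided ideal
  have htop : isotypicComponent (DiffOp F) (QuotModule c) S = ⊤ := by
    set I := (isotypicComponent (DiffOp F) (QuotModule c) S).comap (leftIdeal c).mkQ with hI
    have hmap : I.map (leftIdeal c).mkQ = isotypicComponent (DiffOp F) (QuotModule c) S :=
      Submodule.map_comap_eq_of_surjective (leftIdeal c).mkQ_surjective _
    have hItop : I = ⊤ := by
      refine eq_top_of_two_sided p hN (fun A hA B => ?_) (lt_of_le_of_ne ?_ ?_)
      · have hB : leftIdeal c ≤ (leftIdeal c).comap (LinearMap.toSpanSingleton (DiffOp F) _ B) := by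
          rw [leftIdeal_le_iff, Submodule.mem_comap, LinearMap.toSpanSingleton_apply, smul_eq_mul,
            (hcomm B).eq]
          exact mem_leftIdeal.2 ⟨B, rfl⟩
        exact Submodule.IsFullyInvariant.isotypicComponent (DiffOp F) (QuotModule c) S
          ((leftIdeal c).mapQ _ _ hB) hA
      · rw [hI, ← Submodule.map_le_iff_le_comap, Submodule.mkQ_map_self]
        exact bot_le
      · intro h
        have hbot := bot_lt_isotypicComponent S
        rw [← hmap, ← h, Submodule.mkQ_map_self] at hbot
        exact lt_irrefl _ hbot
    rw [← hmap, hItop, Submodule.map_top, Submodule.range_mkQ]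
  have hiso := IsIsotypicOfType.of_isotypicComponent_eq_top htop
  have : IsSemisimpleModule (DiffOp F) (QuotModule c) := by
    have h : IsSemisimpleModule (DiffOp F) (isotypicComponent (DiffOp F) (QuotModule c) S) :=
      inferInstance
    rw [htop] at h
    exact IsSemisimpleModule.congr Submodule.topEquiv.symm
  obtain ⟨n, ⟨e⟩⟩ := hiso.linearEquiv_fun
  have : Module.Finite (RatFunc F) S :=
    Module.Finite.of_injective (S.subtype.restrictScalars (RatFunc F)) S.injective_subtype
  have hfin : c.ord = n * Module.finrank (RatFunc F) S := by
    rw [← finrank_quotModule hc0, (e.restrictScalars (RatFunc F)).finrank_eq,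
      Module.finrank_pi_fintype, Finset.sum_const, Finset.card_univ, Fintype.card_fin, smul_eq_mul]
  obtain ⟨r, hr, hgen⟩ := finrank_eq_natDegree_mul p hN (V := S)
    fun v => Subtype.ext (hkill v)
  have hnr : n * r = p := by
    rw [hord, hr] at hfin
    refine Nat.eq_of_mul_eq_mul_left (Nat.pos_of_ne_zero hdeg) ?_
    rw [hfin]
    ring
  have hn : n ≠ 1 := by
    rintro rfl
    have hsimple : IsSimpleModule (DiffOp F) (QuotModule c) :=
      IsSimpleModule.congr (e.trans (LinearEquiv.funUnique (Fin 1) (DiffOp F) S))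
    rw [isSimpleModule_iff_isCoatom] at hsimple
    refine hred ⟨hcunit, fun {A B} hAB => ?_⟩
    have hA : A ≠ 0 := left_ne_zero_of_mul (hAB ▸ hc0)
    have hB : B ≠ 0 := right_ne_zero_of_mul (hAB ▸ hc0)
    rcases hsimple.le_iff.1 (leftIdeal_le_iff.2 (mem_leftIdeal.2 ⟨A, hAB⟩)) with h | h
    · exact Or.inr ((isUnit_iff hB).2 ((leftIdeal_eq_top_iff hB).1 h))
    · obtain ⟨Z, hZ⟩ := mem_leftIdeal.1 (h ▸ Submodule.mem_span_singleton_self B : B ∈ leftIdeal c)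
      have hAZ : A * Z = 1 := mul_right_cancel₀ hc0 (by rw [mul_assoc, ← hZ, ← hAB, one_mul])
      exact Or.inl (IsUnit.of_mul_eq_one Z hAZ)
  have hr1 : r = 1 := by
    rcases (Nat.dvd_prime hp.out).1 (Dvd.intro _ hnr) with h | h
    · exact absurd h hn
    · rw [h] at hnr
      exact Nat.eq_of_mul_eq_mul_left hp.out.pos (hnr.trans (mul_one p).symm)
  have : Nontrivial S := IsSimpleModule.nontrivial (DiffOp F) S
  obtain ⟨s, hs⟩ := exists_ne (0 : S)
  obtain ⟨f, hf⟩ := hgen hr1 s hs ((del : DiffOp F) • s)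
  exact ⟨s, f, fun h => hs (Subtype.ext h), congrArg Subtype.val hf⟩

end Simple

/-! ### Twisted powers and lifting -/

section Lifting

variable {F : Type*} [Field F] (p : ℕ) [hp : Fact p.Prime] [hchar : CharP F p]

/-- The operator `a ↦ a' - u a` on `F(t)[Y]`. -/
def twist (u : (RatFunc F)[X]) : (RatFunc F)[X] →+ (RatFunc F)[X] :=
  ddtCoeff - AddMonoidHom.mulLeft u

theorem twist_apply (u a : (RatFunc F)[X]) : twist u a = ddtCoeff a - u * a := rfl

/-- Leibniz formula for the powers of `x - u(∂ ^ p)`, where `x` acts on polynomials in `∂ ^ p` by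
the same commutation rule as `∂`. -/
theorem sub_evalDel_pow {x : DiffOp F}
    (hx : ∀ a, x * evalDel p a = evalDel p a * x + evalDel p (ddtCoeff a))
    (u : (RatFunc F)[X]) (n : ℕ) :
    (x - evalDel p u) ^ n = ∑ ij ∈ Finset.HasAntidiagonal.antidiagonal n,
      n.choose ij.1 • (evalDel p ((twist u)^[ij.1] 1) * x ^ ij.2) := by
  have h : ∀ a (M : DiffOp F), (x - evalDel p u) * (evalDel p a * M) =
      evalDel p (twist u a) * M + evalDel p a * (x * M) := by
    intro a M
    rw [← mul_assoc, sub_mul, hx, twist_apply, map_sub, map_mul, add_sub_assoc, add_mul, mul_assoc,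
      add_comm]
  induction n with
  | zero => simp
  | succ n ih =>
    rw [Finset.sum_antidiagonal_choose_succ_nsmul
      (fun i j => evalDel p ((twist u)^[i] 1) * x ^ j), pow_succ', ih, Finset.mul_sum,
      ← Finset.sum_add_distrib]
    refine Finset.sum_congr rfl fun ij hij => ?_
    rw [mul_smul_comm, h, ← pow_succ', ← Function.iterate_succ_apply' (twist u), smul_add, add_comm]
    congr 2
    rw [Nat.choose_symm_of_eq_add (Finset.HasAntidiagonal.mem_antidiagonal.1 hij).symm]

/-- In characteristic `p` only the two outer terms of the Leibniz formula for the `p`-th power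
survive. -/
theorem sub_evalDel_pow_char {x : DiffOp F}
    (hx : ∀ a, x * evalDel p a = evalDel p a * x + evalDel p (ddtCoeff a)) (u : (RatFunc F)[X]) :
    (x - evalDel p u) ^ p = x ^ p + evalDel p ((twist u)^[p] 1) := by
  have := charP_diffOp (F := F) p
  have hsub : ({(0, p), (p, 0)} : Finset (ℕ × ℕ)) ⊆ Finset.HasAntidiagonal.antidiagonal p := by
    intro ij hij
    simp only [Finset.mem_insert, Finset.mem_singleton] at hij
    rcases hij with rfl | rfl <;> simp
  rw [sub_evalDel_pow p hx, ← Finset.sum_subset hsub, Finset.sum_pair]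
  · simp
  · simp [hp.out.ne_zero.symm]
  · rintro ⟨i, j⟩ hij hne
    have hij' := Finset.HasAntidiagonal.mem_antidiagonal.1 hij
    have hi : i ≠ 0 := by
      rintro rfl
      simp at hij' hne
      exact hne.1 hij'
    have hip : i ≠ p := by
      rintro rfl
      simp at hij' hne
      exact hne.2 hij'
    have hdvd : p ∣ p.choose i := hp.out.dvd_choose_self hi (by simp at hij'; omega)
    rw [← Nat.cast_smul_eq_nsmul (DiffOp F), (CharP.cast_eq_zero_iff (DiffOp F) p _).2 hdvd,
      zero_smul]

theorem sub_evalDel_mul_evalDel (f a : (RatFunc F)[X]) :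
    (del - evalDel p f) * evalDel p a =
      evalDel p a * (del - evalDel p f) + evalDel p (ddtCoeff a) := by
  rw [sub_mul, mul_sub, del_mul_evalDel, ← map_mul, ← map_mul, mul_comm f a, add_sub_right_comm]

theorem iterate_ddt_X_pow (n : ℕ) :
    (⇑(ddt (F := F)))^[n] (RatFunc.X ^ n) = (n.factorial : RatFunc F) := by
  have hpoly : ∀ (a : F[X]) (n : ℕ), (⇑(ddt (F := F)))^[n] (algebraMap F[X] (RatFunc F) a) =
      algebraMap F[X] (RatFunc F) (derivative^[n] a) := by
    intro a n
    induction n with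
    | zero => rfl
    | succ n ih => rw [Function.iterate_succ_apply', ih, ddt_algebraMap,
        Function.iterate_succ_apply']
  rw [← RatFunc.algebraMap_X, ← map_pow, hpoly, iterate_derivative_X_pow_eq_natCast_mul]
  simp [Nat.descFactorial_self]

theorem iterate_ddtCoeff_mul_of_const {a : (RatFunc F)[X]} (ha : ddtCoeff a = 0)
    (b : (RatFunc F)[X]) (n : ℕ) : (⇑ddtCoeff)^[n] (a * b) = a * (⇑ddtCoeff)^[n] b := by
  induction n with
  | zero => rfl
  | succ n ih => rw [Function.iterate_succ_apply', ih, ddtCoeff_mul_of_const ha,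
      Function.iterate_succ_apply']

theorem iterate_ddtCoeff_C (f : RatFunc F) (n : ℕ) :
    (⇑ddtCoeff)^[n] (C f) = C ((⇑(ddt (F := F)))^[n] f) := by
  induction n with
  | zero => rfl
  | succ n ih => rw [Function.iterate_succ_apply', ih, ddtCoeff_C, Function.iterate_succ_apply']

/-- Constants are `(p - 1)`-st derivatives: `(t ^ (p - 1))^{(p - 1)} = (p - 1)!` is invertible. -/
theorem exists_iterate_ddtCoeff_eq {h : (RatFunc F)[X]} (hh : ddtCoeff h = 0) :
    ∃ g, (⇑ddtCoeff)^[p - 1] g = h := by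
  have := charP_ratFunc (F := F) p
  have hfac : ((p - 1).factorial : RatFunc F) ≠ 0 := by
    rw [Ne, CharP.cast_eq_zero_iff (RatFunc F) p, hp.out.dvd_factorial]
    have := hp.out.pos
    omega
  have hc : ddtCoeff (h * C ((p - 1).factorial : RatFunc F)⁻¹) = 0 := by
    rw [ddtCoeff_mul_of_const hh, ddtCoeff_C, Derivation.leibniz_inv, Derivation.map_natCast]
    simp
  refine ⟨h * C ((p - 1).factorial : RatFunc F)⁻¹ * C (RatFunc.X ^ (p - 1)), ?_⟩
  rw [iterate_ddtCoeff_mul_of_const hc, iterate_ddtCoeff_C, iterate_ddt_X_pow, mul_assoc, ← C_mul,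
    inv_mul_cancel₀ hfac, C_1, mul_one]

/-- To first order in `u`, iterating `twist u` on `1` only sees a derivative of `u`. -/
theorem exists_iterate_twist {M : (RatFunc F)[X]} (hM : ddtCoeff M = 0) (g : (RatFunc F)[X])
    (n : ℕ) : ∃ w, (twist (M * g))^[n + 1] 1 = M * (M * w - (⇑ddtCoeff)^[n] g) := by
  induction n with
  | zero =>
    refine ⟨0, ?_⟩
    rw [zero_add, Function.iterate_one, twist_apply, ← C_1, ddtCoeff_C,
      Derivation.map_one_eq_zero, Function.iterate_zero_apply]
    simp
  | succ n ih =>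
    obtain ⟨w, hw⟩ := ih
    refine ⟨ddtCoeff w - g * (M * w - (⇑ddtCoeff)^[n] g), ?_⟩
    rw [Function.iterate_succ_apply', hw, twist_apply, ddtCoeff_mul_of_const hM, map_sub,
      ddtCoeff_mul_of_const hM, Function.iterate_succ_apply' _ n]
    ring

/-- Hensel lifting: if `(∂ - f(∂ ^ p)) ^ p` vanishes modulo the constant polynomial `M`, then `f`
can be corrected so that it vanishes modulo arbitrary powers of `M`. -/
theorem exists_lift {M f h : (RatFunc F)[X]} (hM : ddtCoeff M = 0) (hM0 : M ≠ 0)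
    (hf : (del - evalDel p f) ^ p = evalDel p (M * h)) (k : ℕ) :
    ∃ f h, (del - evalDel p f) ^ p = evalDel p (M ^ (k + 1) * h) := by
  induction k with
  | zero => exact ⟨f, h, by rwa [zero_add, pow_one]⟩
  | succ k ih =>
    clear hf h f
    obtain ⟨f, h, hf⟩ := ih
    have hMk := ddtCoeff_pow_of_const hM (k + 1)
    -- `h` is constant because `(∂ - f) ^ p` commutes with `∂ - f`
    have hh : ddtCoeff h = 0 := by
      have h1 := sub_evalDel_mul_evalDel p f (M ^ (k + 1) * h)
      rw [← hf, (Commute.pow_self (del - evalDel p f) p).eq, left_eq_add,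
        map_eq_zero_iff _ (evalDel_injective p), ddtCoeff_mul_of_const hMk] at h1
      exact (mul_eq_zero.1 h1).resolve_left (pow_ne_zero _ hM0)
    obtain ⟨g, hg⟩ := exists_iterate_ddtCoeff_eq p hh
    obtain ⟨w, hw⟩ := exists_iterate_twist hMk g (p - 1)
    rw [Nat.sub_add_cancel hp.out.one_le, hg] at hw
    refine ⟨f + M ^ (k + 1) * g, M ^ k * w, ?_⟩
    rw [map_add, ← sub_sub, sub_evalDel_pow_char p (sub_evalDel_mul_evalDel p f), hw, hf, ← map_add]
    congr 1
    ring

end Lifting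

end DiffOp

/-! ### Primary modules over principal ideal domains -/

section Primary

variable {R V : Type*} [CommRing R] [AddCommGroup V] [Module R V] {ι ι' : Type*} [Fintype ι]
  [Fintype ι']

/-- The elements `wᵢ` generate the `R`-module `V`, which is the direct sum of the submodules
`R wᵢ ≃ R/(q ^ kᵢ)`. Exponents `kᵢ = 0`, for which `wᵢ = 0`, are allowed. -/
def IsPrimaryBasis (q : R) (k : ι → ℕ) (w : ι → V) : Prop :=
  (∀ v, ∃ a : ι → R, v = ∑ i, a i • w i) ∧
    ∀ a : ι → R, ∑ i, a i • w i = 0 ↔ ∀ i, q ^ k i ∣ a i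

namespace IsPrimaryBasis

variable {q : R} {k : ι → ℕ} {w : ι → V} {k' : ι' → ℕ} {w' : ι' → V}

theorem exists_linearEquiv (h : IsPrimaryBasis q k w) :
    ∃ E : V ≃ₗ[R] ((i : ι) → R ⧸ Ideal.span {q ^ k i}), ∀ (a : ι → R) (i : ι),
      E (∑ i, a i • w i) i = Ideal.Quotient.mk _ (a i) := by
  let f : (ι → R) →ₗ[R] V := Fintype.linearCombination R w
  let g : (ι → R) →ₗ[R] ((i : ι) → R ⧸ Ideal.span {q ^ k i}) :=
    LinearMap.pi fun i => (Submodule.mkQ (Ideal.span {q ^ k i})).comp (LinearMap.proj i)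
  have hf : Function.Surjective f := fun v => (h.1 v).imp fun a ha => ha.symm
  have hg : Function.Surjective g := fun v => by
    choose a ha using fun i => Submodule.Quotient.mk_surjective _ (v i)
    exact ⟨a, funext ha⟩
  have hker : LinearMap.ker f = LinearMap.ker g := by
    ext a
    rw [LinearMap.mem_ker, LinearMap.mem_ker]
    refine (h.2 a).trans ?_
    rw [funext_iff]
    exact forall_congr' fun i => by
      rw [← Ideal.mem_span_singleton, ← Submodule.Quotient.mk_eq_zero]
      rfl
  refine ⟨((f.quotKerEquivOfSurjective hf).symm.trans (Submodule.quotEquivOfEq _ _ hker)).trans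
    (g.quotKerEquivOfSurjective hg), fun a i => ?_⟩
  have : (f.quotKerEquivOfSurjective hf).symm (f a) = Submodule.Quotient.mk a := by
    rw [LinearEquiv.symm_apply_eq]
    rfl
  change (g.quotKerEquivOfSurjective hg) (Submodule.quotEquivOfEq _ _ hker
    ((f.quotKerEquivOfSurjective hf).symm (f a))) i = _
  rw [this]
  rfl

theorem of_linearEquiv [DecidableEq ι] (E : V ≃ₗ[R] ((i : ι) → R ⧸ Ideal.span {q ^ k i})) :
    IsPrimaryBasis q k fun i => E.symm (Pi.single i (Ideal.Quotient.mk _ 1)) := by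
  have hsum : ∀ a : ι → R, ∑ i, a i • E.symm (Pi.single i (Ideal.Quotient.mk _ 1)) =
      E.symm fun i => Ideal.Quotient.mk _ (a i) := by
    intro a
    simp_rw [← map_smul, ← map_sum]
    congr 1
    ext i
    rw [Finset.sum_apply, Finset.sum_eq_single i]
    · rw [Pi.smul_apply, Pi.single_eq_same, Algebra.smul_def, map_one, mul_one]
      rfl
    · intro j _ hj
      rw [Pi.smul_apply, Pi.single_eq_of_ne hj.symm, smul_zero]
    · simp
  refine ⟨fun v => ?_, fun a => ?_⟩
  · choose a ha using fun i => Ideal.Quotient.mk_surjective (E v i)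
    refine ⟨a, ?_⟩
    rw [hsum, LinearEquiv.eq_symm_apply]
    ext i
    exact (ha i).symm
  · rw [hsum, LinearEquiv.map_eq_zero_iff, funext_iff]
    exact forall_congr' fun i => by
      rw [Pi.zero_apply, Ideal.Quotient.eq_zero_iff_mem, Ideal.mem_span_singleton]

theorem reindex (h : IsPrimaryBasis q k w) (σ : ι' ≃ ι) :
    IsPrimaryBasis q (k ∘ σ) (w ∘ σ) := by
  refine ⟨fun v => ?_, fun a => ?_⟩
  · obtain ⟨a, rfl⟩ := h.1 v
    exact ⟨a ∘ σ, (σ.sum_comp fun i => a i • w i).symm⟩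
  · have := h.2 (a ∘ σ.symm)
    rw [← σ.sum_comp, ← σ.forall_congr_right] at this
    simpa using this

theorem pow_smul_eq_zero (h : IsPrimaryBasis q k w) (i : ι) : q ^ k i • w i = 0 := by
  classical
  have := (h.2 (Pi.single i (q ^ k i))).2 fun j => by
    rcases eq_or_ne j i with rfl | hj
    · rw [Pi.single_eq_same]
    · rw [Pi.single_eq_of_ne hj]
      exact dvd_zero _
  rwa [Finset.sum_eq_single i (fun j _ hj => by rw [Pi.single_eq_of_ne hj, zero_smul])
    (by simp), Pi.single_eq_same] at this

theorem subtype_ne_zero (h : IsPrimaryBasis q k w) :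
    IsPrimaryBasis q (fun i : {i // k i ≠ 0} => k i) (fun i => w i) := by
  classical
  have hw : ∀ i, k i = 0 → w i = 0 := by
    intro i hi
    have := h.pow_smul_eq_zero i
    rwa [hi, pow_zero, one_smul] at this
  have hsum : ∀ a : ι → R, ∑ i : {i // k i ≠ 0}, a i • w i = ∑ i, a i • w i := by
    intro a
    rw [← Fintype.sum_subtype_add_sum_subtype (fun i => k i ≠ 0) fun i => a i • w i, left_eq_add]
    exact Finset.sum_eq_zero fun i _ => by rw [hw i (not_not.1 i.2), smul_zero]
  refine ⟨fun v => ?_, fun a => ?_⟩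
  · obtain ⟨a, rfl⟩ := h.1 v
    exact ⟨fun i => a i, (hsum a).symm⟩
  · have h1 := hsum fun i => if hi : k i ≠ 0 then a ⟨i, hi⟩ else 0
    have h2 : ∀ i : {i // k i ≠ 0}, (if hi : k i ≠ 0 then a ⟨i, hi⟩ else 0) = a i := fun i =>
      dif_pos i.2
    simp_rw [h2] at h1
    rw [h1, h.2, Subtype.forall]
    refine forall_congr' fun i => ?_
    by_cases hi : k i ≠ 0
    · simp [hi]
    · simp only [hi, dite_false, dvd_zero, true_iff]
      exact fun h => absurd h id

/-- Multiplication by `q ^ j` lowers the exponents by `j`. -/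
theorem range_lsmul [IsDomain R] (hq : q ≠ 0) (h : IsPrimaryBasis q k w) (j : ℕ) :
    IsPrimaryBasis q (fun i => k i - j)
      (fun i => (LinearMap.lsmul R V (q ^ j)).rangeRestrict (w i)) := by
  have hsum : ∀ a : ι → R, ∑ i, a i • (LinearMap.lsmul R V (q ^ j)).rangeRestrict (w i) =
      (LinearMap.lsmul R V (q ^ j)).rangeRestrict (∑ i, a i • w i) := by
    intro a
    simp_rw [map_sum, map_smul]
  refine ⟨fun v => ?_, fun a => ?_⟩
  · obtain ⟨v, rfl⟩ := (LinearMap.lsmul R V (q ^ j)).surjective_rangeRestrict v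
    obtain ⟨a, rfl⟩ := h.1 v
    exact ⟨a, (hsum a).symm⟩
  · have h1 := h.2 fun i => q ^ j * a i
    simp_rw [mul_smul, ← Finset.smul_sum] at h1
    rw [hsum, ← Subtype.coe_inj]
    refine h1.trans (forall_congr' fun i => ?_)
    change _ ↔ q ^ (k i - j) ∣ a i
    rcases le_total j (k i) with hj | hj
    · obtain ⟨m, hm⟩ := Nat.exists_eq_add_of_le hj
      rw [hm, Nat.add_sub_cancel_left, pow_add, mul_dvd_mul_iff_left (pow_ne_zero j hq)]
    · rw [Nat.sub_eq_zero_of_le hj, pow_zero]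
      exact iff_of_true (Dvd.dvd.mul_right (pow_dvd_pow q hj) _) (one_dvd _)

end IsPrimaryBasis

theorem exists_isPrimaryBasis_of_isTorsion' [IsDomain R] [IsPrincipalIdealRing R]
    [Module.Finite R V] {q : R} (hq : Irreducible q)
    (hV : Module.IsTorsion' V (Submonoid.powers q)) :
    ∃ (d : ℕ) (k : Fin d → ℕ) (w : Fin d → V), IsPrimaryBasis q k w := by
  obtain ⟨d, k, ⟨e⟩⟩ := Module.torsion_by_prime_power_decomposition hq hV
  exact ⟨d, k, _, .of_linearEquiv (e.trans (DirectSum.linearEquivFunOnFintype R (Fin d) _))⟩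

theorem sum_sub_add_sum_sub (m : ι → ℕ) (n : ℕ) :
    ∑ i, (m i - n) + ∑ i, (m i - (n + 2)) =
      2 * ∑ i, (m i - (n + 1)) + Nat.card {i // m i = n + 1} := by
  classical
  rw [Nat.card_eq_fintype_card, Fintype.card_subtype, Finset.card_filter, Finset.mul_sum,
    ← Finset.sum_add_distrib, ← Finset.sum_add_distrib]
  refine Finset.sum_congr rfl fun i _ => ?_
  split_ifs <;> omega

/-- A family of positive integers `kᵢ` is determined, up to a permutation, by the sums of the
truncated differences `kᵢ - j`: their second differences count the `i` with `kᵢ = j`. -/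
theorem exists_equiv_of_sum_sub_eq {k : ι → ℕ} {k' : ι' → ℕ} (hk : ∀ i, k i ≠ 0)
    (hk' : ∀ i, k' i ≠ 0) (h : ∀ j, ∑ i, (k i - j) = ∑ i, (k' i - j)) :
    ∃ σ : ι ≃ ι', ∀ i, k' (σ i) = k i := by
  classical
  have hcard : ∀ n, Fintype.card {i // k i = n} = Fintype.card {i // k' i = n} := by
    intro n
    rcases n with _ | n
    · have : IsEmpty {i // k i = 0} := ⟨fun i => hk i i.2⟩
      have : IsEmpty {i // k' i = 0} := ⟨fun i => hk' i i.2⟩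
      rw [Fintype.card_eq_zero, Fintype.card_eq_zero]
    · have h1 := sum_sub_add_sum_sub k n
      have h2 := sum_sub_add_sum_sub k' n
      rw [h, h, h] at h1
      rw [← Nat.card_eq_fintype_card, ← Nat.card_eq_fintype_card]
      omega
  refine ⟨(Equiv.sigmaFiberEquiv k).symm.trans ((Equiv.sigmaCongrRight fun n =>
    Fintype.equivOfCardEq (hcard n)).trans (Equiv.sigmaFiberEquiv k')), fun i => ?_⟩
  exact (Fintype.equivOfCardEq (hcard (k i)) ⟨i, rfl⟩).2

namespace IsPrimaryBasis

variable {K W : Type*} [Field K] [AddCommGroup W] [Module K W] [Module K[X] W]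
  [IsScalarTower K K[X] W] {q : K[X]} {k : ι → ℕ} {w : ι → W} {k' : ι' → ℕ} {w' : ι' → W}

theorem finrank_eq (hq : q ≠ 0) (h : IsPrimaryBasis q k w) :
    Module.finrank K W = ∑ i, k i * q.natDegree := by
  obtain ⟨E, -⟩ := h.exists_linearEquiv
  have hfin : ∀ i, Module.Finite K (K[X] ⧸ Ideal.span {q ^ k i}) := fun i =>
    (AdjoinRoot.powerBasis (pow_ne_zero (k i) hq)).finite
  rw [(E.restrictScalars K).finrank_eq, Module.finrank_pi_fintype]
  refine Finset.sum_congr rfl fun i _ => ?_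
  rw [finrank_quotient_span_eq_natDegree, natDegree_pow]

/-- The nonzero exponents are unique up to a permutation: the dimension of `q ^ j W` is
`deg q * ∑ (kᵢ - j)`, and these numbers for all `j` determine the exponents. -/
theorem exists_equiv (hq : q ≠ 0) (hdeg : q.natDegree ≠ 0) (h : IsPrimaryBasis q k w)
    (h' : IsPrimaryBasis q k' w') (hk : ∀ i, k i ≠ 0) (hk' : ∀ i, k' i ≠ 0) :
    ∃ σ : ι ≃ ι', ∀ i, k' (σ i) = k i := by
  refine exists_equiv_of_sum_sub_eq hk hk' fun j => ?_
  have h1 := (h.range_lsmul hq j).finrank_eq hq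
  rw [(h'.range_lsmul hq j).finrank_eq hq, ← Finset.sum_mul, ← Finset.sum_mul] at h1
  exact (Nat.eq_of_mul_eq_mul_right (Nat.pos_of_ne_zero hdeg) h1).symm

end IsPrimaryBasis

end Primary

namespace DiffOp

/-! ### Descent to the constants -/

section Descent

variable {F : Type*} [Field F] (p : ℕ) [hp : Fact p.Prime] [hchar : CharP F p]

/-- If `N(∂ ^ p)` is reducible, then `∂` can be twisted by a polynomial in `∂ ^ p` so that its
`p`-th power vanishes modulo any given power of `N(∂ ^ p)`. -/
theorem exists_sub_evalDel_pow_eq {N : (RatFunc F)[X]} (hN : Irreducible N) (hδ : ddtCoeff N = 0)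
    (hred : ¬ Irreducible (evalDel p N)) (k : ℕ) :
    ∃ f h : (RatFunc F)[X], ((del : DiffOp F) - evalDel p f) ^ p = evalDel p (N ^ (k + 1) * h) := by
  obtain ⟨s, f, hs, hf⟩ := exists_del_smul_eq p hN hδ hred
  have hpow := sub_evalDel_pow_char p (del_mul_evalDel (F := F) p) f
  rw [← evalDel_X, ← map_add] at hpow
  have hker : evalDel p (X + (⇑(twist f))^[p] 1) • s = 0 := by
    rw [← hpow, ← pow_sub_one_mul hp.out.ne_zero, mul_smul, sub_smul, hf, sub_self,
      smul_zero]
  have hNs : evalDel p N • s = 0 := by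
    obtain ⟨A, rfl⟩ := (leftIdeal (evalDel p N)).mkQ_surjective s
    rw [← map_smul, Submodule.mkQ_apply, Submodule.Quotient.mk_eq_zero, smul_eq_mul,
      (commute_evalDel p hδ A).eq]
    exact mem_leftIdeal.2 ⟨A, rfl⟩
  have hdvd : N ∣ X + (⇑(twist f))^[p] 1 := by
    by_contra hnd
    obtain ⟨u, v, huv⟩ := (hN.coprime_iff_not_dvd).2 hnd
    apply hs
    rw [← one_smul (DiffOp F) s, ← map_one (evalDel p), ← huv, map_add, map_mul, map_mul, add_smul,
      mul_smul, mul_smul, hNs, hker, smul_zero, smul_zero, add_zero]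
  obtain ⟨h, hh⟩ := hdvd
  exact exists_lift p hδ hN.ne_zero (hpow.trans (by rw [hh])) k

theorem iterate_ddt_X_pow_of_lt {i n : ℕ} (h : i < n) :
    (⇑(ddt (F := F)))^[n] (RatFunc.X ^ i) = 0 := by
  obtain ⟨m, rfl⟩ : ∃ m, n = m + 1 + i := ⟨n - i - 1, by omega⟩
  rw [Function.iterate_add_apply, iterate_ddt_X_pow, Function.iterate_succ_apply,
    Derivation.map_natCast]
  induction m with
  | zero => rfl
  | succ m ih => rw [Function.iterate_succ_apply', ih (by omega), map_zero]

variable {M : Type*} [AddCommGroup M] [Module (DiffOp F) M] [Module (RatFunc F) M]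
  [IsScalarTower (RatFunc F) (DiffOp F) M] (f : (RatFunc F)[X])

theorem sub_evalDel_smul_smul {m : M} (hm : (del - evalDel p f) • m = 0) (g : RatFunc F) (n : ℕ) :
    (del - evalDel p f) ^ n • g • m = (⇑(ddt (F := F)))^[n] g • m := by
  induction n with
  | zero => rw [pow_zero, one_smul, Function.iterate_zero_apply]
  | succ n ih =>
    have h := sub_evalDel_mul_evalDel p f (C ((⇑(ddt (F := F)))^[n] g))
    rw [ddtCoeff_C, evalDel_C, evalDel_C] at h
    rw [pow_succ', mul_smul, ih, ← coeff_smul, ← mul_smul, h, add_smul, mul_smul, hm, smul_zero,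
      zero_add, coeff_smul, Function.iterate_succ_apply']

theorem factorial_ne_zero_of_lt {j : ℕ} (hj : j < p) : (j.factorial : RatFunc F) ≠ 0 := by
  have := charP_ratFunc (F := F) p
  rw [Ne, CharP.cast_eq_zero_iff (RatFunc F) p, hp.out.dvd_factorial]
  omega

theorem sub_evalDel_smul_smul_of_const {m : M} (hm : (del - evalDel p f) • m = 0) (g : RatFunc F)
    (hg : ddt g = 0) : (del - evalDel p f) • g • m = 0 := by
  have := sub_evalDel_smul_smul p f hm g 1
  rwa [pow_one, Function.iterate_one, hg, zero_smul] at this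

/-- A module on which the `p`-th power of `∂ - f(∂ ^ p)` vanishes is generated over `F(t)` by the
kernel of `∂ - f(∂ ^ p)`. -/
theorem exists_sum_X_pow_smul {j : ℕ} (hj : j ≤ p) {m : M}
    (hm : (del - evalDel p f) ^ j • m = 0) :
    ∃ w : ℕ → M, (∀ i, (del - evalDel p f) • w i = 0) ∧
      m = ∑ i ∈ Finset.range p, (RatFunc.X ^ i : RatFunc F) • w i := by
  induction j generalizing m with
  | zero => exact ⟨0, fun i => smul_zero _, by simpa using hm⟩
  | succ j ih =>
    have hj0 := factorial_ne_zero_of_lt (F := F) p hj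
    set u : M := (j.factorial : RatFunc F)⁻¹ • (del - evalDel p f) ^ j • m with hu
    have hu0 : (del - evalDel p f) • u = 0 := by
      refine sub_evalDel_smul_smul_of_const p f ?_ _ ?_
      · rw [← mul_smul, ← pow_succ', hm]
      · rw [Derivation.leibniz_inv, Derivation.map_natCast, smul_zero]
    obtain ⟨w, hw, hsum⟩ := ih (by omega) (m := m - (RatFunc.X ^ j : RatFunc F) • u) (by
      rw [smul_sub, sub_evalDel_smul_smul p f hu0, iterate_ddt_X_pow, hu, smul_inv_smul₀ hj0,
        sub_self])
    refine ⟨w + Pi.single j u, fun i => ?_, ?_⟩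
    · rw [Pi.add_apply, smul_add, hw, zero_add]
      rcases eq_or_ne i j with rfl | h
      · rwa [Pi.single_eq_same]
      · rw [Pi.single_eq_of_ne h, smul_zero]
    · simp_rw [Pi.add_apply, smul_add]
      rw [Finset.sum_add_distrib, ← hsum, Finset.sum_eq_single j]
      · rw [Pi.single_eq_same, sub_add_cancel]
      · intro i _ h
        rw [Pi.single_eq_of_ne h, smul_zero]
      · intro h
        exact absurd (Finset.mem_range.2 hj) h

theorem eq_zero_of_sum_X_pow_smul {w : ℕ → M} (hw : ∀ i, (del - evalDel p f) • w i = 0) {n : ℕ}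
    (hn : n ≤ p) (h : ∑ i ∈ Finset.range n, (RatFunc.X ^ i : RatFunc F) • w i = 0) :
    ∀ i < n, w i = 0 := by
  induction n with
  | zero => simp
  | succ n ih =>
    have hwn : w n = 0 := by
      have h1 := congrArg ((del - evalDel p f) ^ n • ·) h
      beta_reduce at h1
      rw [smul_zero, Finset.smul_sum, Finset.sum_range_succ, Finset.sum_eq_zero, zero_add,
        sub_evalDel_smul_smul p f (hw n), iterate_ddt_X_pow] at h1
      · exact (smul_eq_zero.1 h1).resolve_left (factorial_ne_zero_of_lt p hn)
      · intro i hi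
        rw [sub_evalDel_smul_smul p f (hw i), iterate_ddt_X_pow_of_lt (Finset.mem_range.1 hi),
          zero_smul]
    rw [Finset.sum_range_succ, hwn, smul_zero, add_zero] at h
    intro i hi
    rcases (Nat.lt_succ_iff.1 hi).lt_or_eq with hi | rfl
    · exact ih (by omega) h i hi
    · exact hwn

theorem exists_sum_C_X_pow_mul (a : (RatFunc F)[X]) : ∃ b : ℕ → (ConstField F p)[X],
    a = ∑ j ∈ Finset.range p,
      C (RatFunc.X ^ j) * (b j).map (algebraMap (ConstField F p) (RatFunc F)) := by
  induction a using Polynomial.induction_on' with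
  | add a a' ha ha' =>
    obtain ⟨b, rfl⟩ := ha
    obtain ⟨b', rfl⟩ := ha'
    exact ⟨b + b', by simp [mul_add, Finset.sum_add_distrib]⟩
  | monomial n g =>
    obtain ⟨c, rfl⟩ := exists_sum_X_pow p g
    refine ⟨fun j => monomial n (c j), ?_⟩
    simp_rw [map_monomial, C_mul_monomial, map_sum]
    rfl

theorem finite_constField : Module.Finite (ConstField F p) (RatFunc F) := by
  classical
  refine ⟨⟨(Finset.range p).image fun i => (RatFunc.X ^ i : RatFunc F), ?_⟩⟩
  rw [eq_top_iff]
  intro g _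
  obtain ⟨c, rfl⟩ := exists_sum_X_pow p g
  refine Submodule.sum_mem _ fun i hi => ?_
  rw [mul_comm]
  exact Submodule.smul_mem _ (c i) (Submodule.subset_span (Finset.mem_image_of_mem _ hi))

/-- Let `M` be killed by `N(∂ ^ p) ^ ν` and by the `p`-th power of `∂ - f(∂ ^ p)`. As a module over
`F(t)[Y]`, with `Y` acting as `∂ ^ p`, it is a direct sum of modules `F(t)[Y]/(N ^ kᵢ)`, with
generators `wᵢ` killed by `∂ - f(∂ ^ p)`. The structure theorem over `F(t ^ p)[Y]` is applied to
the kernel of `∂ - f(∂ ^ p)`, from which `M` arises by extension of scalars. -/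
theorem exists_generators [Module.Finite (RatFunc F) M] {N : (ConstField F p)[X]}
    (hN : Irreducible N) (hf : ∀ m : M, (del - evalDel p f) ^ p • m = 0) {ν : ℕ}
    (hν : ∀ m : M, evalDelPow p N ^ ν • m = 0) :
    ∃ (d : ℕ) (k : Fin d → ℕ) (w : Fin d → M), (∀ i, (del - evalDel p f) • w i = 0) ∧
      (∀ m, ∃ a : Fin d → (RatFunc F)[X], m = ∑ i, evalDel p (a i) • w i) ∧
      ∀ a : Fin d → (RatFunc F)[X], ∑ i, evalDel p (a i) • w i = 0 ↔
        ∀ i, N.map (algebraMap (ConstField F p) (RatFunc F)) ^ k i ∣ a i := by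
  let ι : (ConstField F p)[X] →+* (RatFunc F)[X] :=
    mapRingHom (algebraMap (ConstField F p) (RatFunc F))
  let : Module (ConstField F p)[X] M := Module.compHom M ((evalDel p).comp ι)
  have hsmul : ∀ (a : (ConstField F p)[X]) (m : M), a • m = evalDel p (ι a) • m := fun _ _ => rfl
  have hι : ∀ a, ddtCoeff (ι a) = 0 := ddtCoeff_map p
  have : IsScalarTower (ConstField F p) (ConstField F p)[X] M := ⟨fun c a m => by
    rw [hsmul, hsmul, smul_eq_C_mul, map_mul, map_mul, mul_smul]
    change evalDel p (map _ (C c)) • _ = _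
    rw [map_C, evalDel_C, coeff_smul]
    rfl⟩
  have := finite_constField (F := F) p
  have : Module.Finite (ConstField F p) M := Module.Finite.trans (RatFunc F) M
  have : Module.Finite (ConstField F p)[X] M :=
    Module.Finite.of_restrictScalars_finite (ConstField F p) _ M
  let M₀ : Submodule (ConstField F p)[X] M :=
    { carrier := {m | (del - evalDel p f) • m = 0}
      zero_mem' := smul_zero _
      add_mem' := fun {a b} ha hb => by
        rw [Set.mem_ofPred_eq] at *
        rw [smul_add, ha, hb, add_zero]
      smul_mem' := fun a m hm => by
        rw [Set.mem_ofPred_eq] at *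
        rw [hsmul, ← mul_smul, sub_evalDel_mul_evalDel, hι, map_zero, add_zero, mul_smul, hm,
          smul_zero] }
  have htors : Module.IsTorsion' M₀ (Submonoid.powers N) := by
    rintro ⟨m, hm⟩
    refine ⟨⟨N ^ ν, ν, rfl⟩, Subtype.ext ?_⟩
    change N ^ ν • m = 0
    rw [hsmul, map_pow, map_pow, ← hν m, evalDelPow_eq]
    rfl
  obtain ⟨d, k, w, hB⟩ := exists_isPrimaryBasis_of_isTorsion' hN htors
  refine ⟨d, k, fun i => w i, fun i => (w i).2, fun m => ?_, fun a => ⟨fun h i => ?_, fun h => ?_⟩⟩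
  · obtain ⟨u, hu, rfl⟩ := exists_sum_X_pow_smul p f le_rfl (hf m)
    choose b hb using fun j => hB.1 ⟨u j, hu j⟩
    refine ⟨fun i => ∑ j ∈ Finset.range p, C (RatFunc.X ^ j) * ι (b j i), ?_⟩
    simp_rw [map_sum, Finset.sum_smul]
    rw [Finset.sum_comm]
    refine Finset.sum_congr rfl fun j _ => ?_
    have h1 : u j = ∑ i, b j i • (w i : M) := by
      have := congrArg M₀.subtype (hb j)
      rwa [map_sum] at this
    rw [h1, Finset.smul_sum]
    refine Finset.sum_congr rfl fun i _ => ?_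
    rw [map_mul, mul_smul, evalDel_C, coeff_smul, hsmul]
  · choose b hb using fun i => exists_sum_C_X_pow_mul p (a i)
    let u : ℕ → M₀ := fun j => ∑ i, b i j • w i
    have hu : ∑ j ∈ Finset.range p, (RatFunc.X ^ j : RatFunc F) • (u j : M) = 0 := by
      rw [← h]
      simp_rw [hb, map_sum, Finset.sum_smul]
      rw [Finset.sum_comm]
      refine Finset.sum_congr rfl fun j _ => ?_
      have h1 : (u j : M) = ∑ i, b i j • (w i : M) := map_sum M₀.subtype _ _
      rw [h1, Finset.smul_sum]
      refine Finset.sum_congr rfl fun i _ => ?_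
      rw [map_mul, mul_smul, evalDel_C, coeff_smul, hsmul]
      rfl
    have hu0 := eq_zero_of_sum_X_pow_smul p f (fun j => (u j).2) le_rfl hu
    rw [hb i]
    refine Finset.dvd_sum fun j hj => Dvd.dvd.mul_left ?_ _
    have := (hB.2 fun i => b i j).1 (Subtype.ext (hu0 j (Finset.mem_range.1 hj))) i
    rw [← Polynomial.map_pow]
    exact Polynomial.map_dvd _ this
  · refine Finset.sum_eq_zero fun i _ => ?_
    obtain ⟨c, hc⟩ := h i
    have h1 : N ^ k i • (w i : M) = 0 := congrArg Subtype.val (hB.pow_smul_eq_zero i)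
    rw [hsmul, map_pow] at h1
    rw [hc, mul_comm, map_mul, mul_smul]
    change evalDel p c • evalDel p (ι N ^ k i) • (w i : M) = 0
    rw [h1, smul_zero]

end Descent

/-! ### Decomposition of operators -/

section Decomposition

variable {F : Type*} [Field F] (p : ℕ) [hp : Fact p.Prime] [hchar : CharP F p]

theorem smul_of_pCurvature (L : DiffOp F) (a : (RatFunc F)[X]) (x : QuotModule L) :
    a • Module.AEval'.of (L.pCurvature p) x =
      Module.AEval'.of (L.pCurvature p) (evalDel p a • x) := by
  induction a using Polynomial.induction_on' with
  | add a b ha hb => rw [add_smul, ha, hb, map_add, add_smul, map_add]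
  | monomial n f =>
    have hpow : (L.pCurvature p ^ n) x = ((del : DiffOp F) ^ p) ^ n • x := by
      induction n with
      | zero => rw [pow_zero, pow_zero, one_smul]; rfl
      | succ n ih =>
        rw [pow_succ', Module.End.mul_apply, ih, pow_succ', mul_smul]
        rfl
    rw [← C_mul_X_pow_eq_monomial, mul_smul, Module.AEval'.X_pow_smul_of, map_mul, map_pow,
      evalDel_C, evalDel_X, mul_smul, coeff_smul, Module.AEval.C_smul, ← map_smul]
    congr 2

/-- An additive subgroup stable under `F(t)` and `∂` is a left ideal. -/
theorem mul_mem_of_stable {J : AddSubgroup (DiffOp F)}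
    (hcoeff : ∀ (g : RatFunc F) (A : DiffOp F), A ∈ J → coeff g * A ∈ J)
    (hdel : ∀ A ∈ J, del * A ∈ J) (B : DiffOp F) {A : DiffOp F} (hA : A ∈ J) : B * A ∈ J := by
  have hpow : ∀ n : ℕ, del ^ n * A ∈ J := by
    intro n
    induction n with
    | zero => rwa [pow_zero, one_mul]
    | succ n ih =>
      rw [pow_succ', mul_assoc]
      exact hdel _ ih
  rw [eq_sum B, Polynomial.sum_def, Finset.sum_mul]
  refine sum_mem fun i _ => ?_
  rw [mul_assoc]
  exact hcoeff _ _ (hpow i)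

/-- An operator `A` is indecomposable if `𝒟 / 𝒟 A` is isomorphic to `F(t)[Y]/(N ^ e)` as a module
over `F(t)[Y]`, with `Y` acting as `∂ ^ p`, because that module is not the sum of two proper
submodules. -/
theorem indecomposable_of_quotient {N : (RatFunc F)[X]} (hN : Irreducible N) {e : ℕ} (he : e ≠ 0)
    {A : DiffOp F} (θ : DiffOp F →+ (RatFunc F)[X] ⧸ Ideal.span {N ^ e})
    (hsurj : Function.Surjective θ) (hθ : ∀ a B, θ (evalDel p a * B) = a • θ B)
    (hker : ∀ B, θ B = 0 → B ∈ leftIdeal A) : A.Indecomposable := by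
  intro hdec
  obtain ⟨L₁, L₂, h₁, h₂, htop, hinf⟩ := hdec.exists_leftIdeal
  have hsmul : ∀ a b : (RatFunc F)[X], a • Ideal.Quotient.mk (Ideal.span {N ^ e}) b =
      Ideal.Quotient.mk _ (a * b) := fun _ _ => rfl
  have key : ∀ M : DiffOp F, M.ord ≠ 0 → leftIdeal A ≤ leftIdeal M → ∀ B ∈ leftIdeal M,
      ∀ b, θ B = Ideal.Quotient.mk _ b → N ∣ b := by
    intro M hM hAM B hB b hb
    by_contra hnd
    -- `b` is invertible modulo `N ^ e`, so `θ` maps `𝒟 M` onto the whole quotient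
    obtain ⟨u, v, huv⟩ := ((hN.coprime_iff_not_dvd).2 hnd).pow_left (m := e)
    refine hM ((leftIdeal_eq_top_iff ?_).1 ?_)
    · rintro rfl
      exact hM natDegree_zero
    · rw [Submodule.eq_top_iff']
      intro Z
      obtain ⟨z, hz⟩ := Ideal.Quotient.mk_surjective (θ Z)
      have hZ : Z - evalDel p (z * v) * B ∈ leftIdeal M := by
        refine hAM (hker _ ?_)
        rw [map_sub, hθ, hb, ← hz, hsmul, ← map_sub, Ideal.Quotient.eq_zero_iff_mem,
          Ideal.mem_span_singleton]
        exact ⟨z * u, by linear_combination (-z) * huv⟩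
      exact (Submodule.sub_mem_iff_left _ (Submodule.smul_mem _ _ hB)).1 hZ
  obtain ⟨Z, hZ⟩ := hsurj (Ideal.Quotient.mk _ 1)
  obtain ⟨B₁, hB₁, B₂, hB₂, rfl⟩ :=
    Submodule.mem_sup.1 (htop ▸ Submodule.mem_top : Z ∈ leftIdeal L₁ ⊔ leftIdeal L₂)
  obtain ⟨b₁, hb₁⟩ := Ideal.Quotient.mk_surjective (θ B₁)
  obtain ⟨b₂, hb₂⟩ := Ideal.Quotient.mk_surjective (θ B₂)
  have hN₁ := key L₁ h₁ (hinf ▸ inf_le_left) B₁ hB₁ b₁ hb₁.symm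
  have hN₂ := key L₂ h₂ (hinf ▸ inf_le_right) B₂ hB₂ b₂ hb₂.symm
  rw [map_add, ← hb₁, ← hb₂, ← map_add, Ideal.Quotient.mk_eq_mk_iff_sub_mem,
    Ideal.mem_span_singleton] at hZ
  have := (dvd_sub_right (dvd_add hN₁ hN₂)).1 ((dvd_pow_self N he).trans hZ)
  exact hN.not_isUnit (isUnit_of_dvd_one this)

/-- If `𝒟 / 𝒟 L` is the direct sum of the submodules `F(t)[Y] wᵢ ≃ F(t)[Y]/(N ^ eᵢ)`, where the
`wᵢ` are killed by `∂ - f(∂ ^ p)`, then each summand is stable under `∂`, and the kernels of the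
projections to the summands are generated by operators that decompose `L`. -/
theorem exists_decomposition {N : (RatFunc F)[X]} (hN : Irreducible N) (hδ : ddtCoeff N = 0)
    {L : DiffOp F} (hL : L ≠ 0) (f : (RatFunc F)[X]) {ι : Type*} [Fintype ι] {e : ι → ℕ}
    (he : ∀ i, e i ≠ 0) {w : ι → QuotModule L} (hw : ∀ i, (del - evalDel p f) • w i = 0)
    (hB : IsPrimaryBasis N e fun i => Module.AEval'.of (L.pCurvature p) (w i)) :
    ∃ Li : ι → DiffOp F, IsLCLM L Li ∧ L.ord = ∑ i, (Li i).ord ∧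
      (∀ i, (Li i).ord = e i * N.natDegree) ∧ ∀ i, (Li i).Indecomposable := by
  obtain ⟨E, hE⟩ := hB.exists_linearEquiv
  have hsum : ∀ a : ι → (RatFunc F)[X],
      ∑ i, a i • Module.AEval'.of (L.pCurvature p) (w i) =
        Module.AEval'.of (L.pCurvature p) (∑ i, evalDel p (a i) • w i) := by
    intro a
    rw [map_sum]
    exact Finset.sum_congr rfl fun i _ => smul_of_pCurvature p L (a i) (w i)
  let θ (i : ι) : DiffOp F →ₗ[RatFunc F] (RatFunc F)[X] ⧸ Ideal.span {N ^ e i} :=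
    (LinearMap.proj i).comp ((E.restrictScalars (RatFunc F)).toLinearMap.comp
      ((Module.AEval'.of (L.pCurvature p)).toLinearMap.comp
        ((leftIdeal L).mkQ.restrictScalars (RatFunc F))))
  have hθ : ∀ i A, θ i A = E (Module.AEval'.of (L.pCurvature p) ((leftIdeal L).mkQ A)) i :=
    fun _ _ => rfl
  have hθ_eq : ∀ A (a : ι → (RatFunc F)[X]),
      (leftIdeal L).mkQ A = ∑ i, evalDel p (a i) • w i →
        ∀ i, θ i A = Ideal.Quotient.mk _ (a i) := by
    intro A a ha i
    rw [hθ, ha, ← hsum, hE]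
  have hrepr : ∀ A, ∃ a : ι → (RatFunc F)[X],
      (leftIdeal L).mkQ A = ∑ i, evalDel p (a i) • w i := by
    intro A
    obtain ⟨a, ha⟩ := hB.1 (Module.AEval'.of (L.pCurvature p) ((leftIdeal L).mkQ A))
    rw [hsum] at ha
    exact ⟨a, (Module.AEval'.of (L.pCurvature p)).injective ha⟩
  have hsurj : ∀ i, Function.Surjective (θ i) := by
    intro i x
    obtain ⟨b, rfl⟩ := Ideal.Quotient.mk_surjective x
    obtain ⟨A, hA⟩ := (leftIdeal L).mkQ_surjective
      (∑ j, evalDel p ((fun _ => b : ι → (RatFunc F)[X]) j) • w j)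
    exact ⟨A, hθ_eq A _ hA i⟩
  have hθ_smul : ∀ i (a : (RatFunc F)[X]) (B : DiffOp F), θ i (evalDel p a * B) = a • θ i B := by
    intro i a B
    rw [hθ, hθ, ← smul_eq_mul, map_smul, ← smul_of_pCurvature, map_smul, Pi.smul_apply]
  have hdel : ∀ i A, θ i A = 0 → θ i (del * A) = 0 := by
    intro i A hA
    obtain ⟨a, ha⟩ := hrepr A
    have h1 : (leftIdeal L).mkQ (del * A) =
        ∑ j, evalDel p (a j * f + ddtCoeff (a j)) • w j := by
      rw [← smul_eq_mul, map_smul, ha, Finset.smul_sum]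
      refine Finset.sum_congr rfl fun j _ => ?_
      have hj := hw j
      rw [sub_smul, sub_eq_zero] at hj
      rw [← mul_smul, del_mul_evalDel, add_smul, mul_smul, hj, map_add, add_smul, map_mul, mul_smul]
    rw [hθ_eq A a ha, Ideal.Quotient.eq_zero_iff_mem, Ideal.mem_span_singleton] at hA
    rw [hθ_eq _ _ h1, Ideal.Quotient.eq_zero_iff_mem, Ideal.mem_span_singleton]
    refine dvd_add (hA.mul_right f) ?_
    obtain ⟨b, hb⟩ := hA
    rw [hb, ddtCoeff_mul_of_const (ddtCoeff_pow_of_const hδ _)]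
    exact dvd_mul_right _ _
  have hJ : ∀ i, ∃ B : DiffOp F, B ≠ 0 ∧ ∀ A, A ∈ leftIdeal B ↔ θ i A = 0 := by
    intro i
    let J : Submodule (DiffOp F) (DiffOp F) :=
      { (LinearMap.ker (θ i)).toAddSubgroup with
        smul_mem' := fun B A hA => mul_mem_of_stable
          (J := (LinearMap.ker (θ i)).toAddSubgroup)
          (fun g A hA => (LinearMap.ker (θ i)).smul_mem g hA) (hdel i) B hA }
    have hmem : ∀ A, A ∈ J ↔ θ i A = 0 := fun A => Iff.rfl
    have hJL : L ∈ J := by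
      rw [hmem, hθ, Submodule.mkQ_apply,
        (Submodule.Quotient.mk_eq_zero _).2 (Submodule.mem_span_singleton_self L), map_zero,
        map_zero, Pi.zero_apply]
    obtain ⟨B, hB, hJB⟩ := exists_monic_generator (I := J) fun h => hL (by rwa [h] at hJL)
    exact ⟨B, hB.ne_zero, fun A => by rw [← hJB, hmem]⟩
  choose Li hLi0 hLi using hJ
  have hord : ∀ i, (Li i).ord = e i * N.natDegree := by
    intro i
    have hker : LinearMap.ker (θ i) = (leftIdeal (Li i)).restrictScalars (RatFunc F) := by
      ext A
      rw [LinearMap.mem_ker, ← hLi]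
      rfl
    have e₁ := (Submodule.Quotient.restrictScalarsEquiv (RatFunc F) (leftIdeal (Li i))).symm.trans
      ((Submodule.quotEquivOfEq _ _ hker.symm).trans ((θ i).quotKerEquivOfSurjective (hsurj i)))
    rw [← finrank_quotModule (hLi0 i), e₁.finrank_eq, finrank_quotient_span_eq_natDegree,
      natDegree_pow]
  refine ⟨Li, ?_, ?_, hord, fun i => ?_⟩
  · refine Submodule.ext fun A => ?_
    rw [Submodule.mem_iInf]
    simp_rw [hLi, hθ]
    rw [← Submodule.Quotient.mk_eq_zero, ← Submodule.mkQ_apply,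
      ← (Module.AEval'.of (L.pCurvature p)).map_eq_zero_iff, ← E.map_eq_zero_iff, funext_iff]
    rfl
  · rw [← finrank_quotModule hL, (Module.AEval'.of (L.pCurvature p)).finrank_eq,
      hB.finrank_eq hN.ne_zero]
    exact Finset.sum_congr rfl fun i _ => (hord i).symm
  · exact indecomposable_of_quotient p hN (he i) (θ i).toAddMonoidHom (hsurj i) (hθ_smul i)
      fun B hB => (hLi i B).2 hB

end Decomposition

end DiffOp

end

theorem mainTheorem2 (p : ℕ) [Fact p.Prime] (F : Type*) [Field F] [Finite F] [CharP F p]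
    (N : (DiffOp.ConstField F p)[X]) (hN_monic : N.Monic) (hN_irr : Irreducible N)
    (hN_sep : N.Separable) (ν : ℕ) (L : DiffOp F) (hL_monic : L.Monic)
    (hL_dvd : (∃ Q : DiffOp F, DiffOp.evalDelPow p N ^ ν = Q * L) ∨
      (∃ Q : DiffOp F, DiffOp.evalDelPow p N ^ ν = L * Q)) :
    (Irreducible (DiffOp.evalDelPow p N) →
      (∃ m : ℕ, m ≤ ν ∧ L = DiffOp.evalDelPow p N ^ m) ∧ L.Indecomposable) ∧
    (¬ Irreducible (DiffOp.evalDelPow p N) →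
      (∃ (k : ℕ) (e : Fin k → ℕ), IsFrobeniusInvariants (L.pCurvature p)
        (fun i => N.map (algebraMap (DiffOp.ConstField F p) (RatFunc F)) ^ e i)) ∧
      ∀ (k : ℕ) (e : Fin k → ℕ), IsFrobeniusInvariants (L.pCurvature p)
        (fun i => N.map (algebraMap (DiffOp.ConstField F p) (RatFunc F)) ^ e i) →
        ∃ Li : Fin k → DiffOp F,
          DiffOp.IsLCLM L Li ∧ L.ord = ∑ i, (Li i).ord ∧
          (∀ i, (Li i).ord = e i * N.natDegree) ∧
          ∀ i, (Li i).Indecomposable) := by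
  set c := DiffOp.evalDelPow p N with hc
  set N' := N.map (algebraMap (DiffOp.ConstField F p) (RatFunc F)) with hN'
  have hcN : c = DiffOp.evalDel p N' := DiffOp.evalDelPow_eq p N
  have hN'_monic : N'.Monic := hN_monic.map _
  have hδ : DiffOp.ddtCoeff N' = 0 := DiffOp.ddtCoeff_map p N
  have hirr : Irreducible N' := DiffOp.irreducible_map p hN_monic hN_irr hN_sep
  have hcomm : ∀ A, Commute c A := fun A => hcN ▸ DiffOp.commute_evalDel p hδ A
  have hc_monic : c.Monic := hcN ▸ DiffOp.monic_evalDel p hN'_monic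
  have hdeg : N'.natDegree ≠ 0 := hirr.natDegree_pos.ne'
  have hNdeg : N.natDegree = N'.natDegree := (natDegree_map _).symm
  obtain ⟨Q, hQ⟩ : ∃ Q : DiffOp F, c ^ ν = Q * L := by
    refine hL_dvd.elim id ?_
    rintro ⟨Q, hQ⟩
    exact ⟨Q, DiffOp.eq_mul_of_eq_mul_comm ((hcomm Q).pow_left ν)
      (pow_ne_zero _ hc_monic.ne_zero) hQ⟩
  refine ⟨fun h => ⟨DiffOp.eq_pow_of_dvd hcomm h hc_monic hL_monic hQ,
    DiffOp.indecomposable_of_dvd hcomm h hQ⟩, fun hred => ?_⟩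
  have := DiffOp.finite_quotModule hL_monic.ne_zero
  have hkill : ∀ x : DiffOp.QuotModule L, c ^ ν • x = 0 := by
    intro x
    obtain ⟨A, rfl⟩ := (DiffOp.leftIdeal L).mkQ_surjective x
    rw [← map_smul, Submodule.mkQ_apply, Submodule.Quotient.mk_eq_zero, smul_eq_mul,
      ((hcomm A).pow_left ν).eq, hQ, ← mul_assoc]
    exact DiffOp.mem_leftIdeal.2 ⟨_, rfl⟩
  obtain ⟨f, h, hf⟩ := DiffOp.exists_sub_evalDel_pow_eq p hirr hδ (hcN ▸ hred) ν
  obtain ⟨d, k₀, w₀, hw₀, hspan, hrel⟩ := DiffOp.exists_generators p f hN_irr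
    (M := DiffOp.QuotModule L) (ν := ν) (fun m => by
      rw [hf, mul_comm, pow_succ', ← mul_assoc, map_mul, map_pow, ← hcN, mul_smul, hkill,
        smul_zero]) hkill
  -- the exponents that are zero are discarded
  have hbasis : IsPrimaryBasis N' k₀ fun i => Module.AEval'.of (L.pCurvature p) (w₀ i) := by
    have hsum : ∀ a : Fin d → (RatFunc F)[X],
        ∑ i, a i • Module.AEval'.of (L.pCurvature p) (w₀ i) =
          Module.AEval'.of (L.pCurvature p) (∑ i, DiffOp.evalDel p (a i) • w₀ i) := by
      intro a
      rw [map_sum]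
      exact Finset.sum_congr rfl fun i _ => DiffOp.smul_of_pCurvature p L (a i) (w₀ i)
    refine ⟨fun v => ?_, fun a => ?_⟩
    · obtain ⟨x, rfl⟩ := (Module.AEval'.of (L.pCurvature p)).surjective v
      obtain ⟨a, rfl⟩ := hspan x
      exact ⟨a, (hsum a).symm⟩
    · rw [hsum, LinearEquiv.map_eq_zero_iff]
      exact hrel a
  have hbasis' := hbasis.subtype_ne_zero
  constructor
  · let σ₀ := (Fintype.equivFin {i // k₀ i ≠ 0}).symm
    let σ := (Tuple.sort fun i => k₀ (σ₀ i)).trans σ₀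
    obtain ⟨E, -⟩ := (hbasis'.reindex σ).exists_linearEquiv
    refine ⟨_, fun i => k₀ (σ i), fun i => ⟨hN'_monic.pow _, ?_⟩, fun i j hij => ?_, ⟨E⟩⟩
    · rw [natDegree_pow]
      exact Nat.pos_of_ne_zero (mul_ne_zero (σ i).2 hdeg)
    · exact pow_dvd_pow _ (Tuple.monotone_sort (fun i => k₀ (σ₀ i)) hij)
  · rintro k e ⟨hpos, -, ⟨E⟩⟩
    have he : ∀ i, e i ≠ 0 := by
      intro i h0
      have := (hpos i).2
      simp [h0] at this
    obtain ⟨σ, hσ⟩ := (IsPrimaryBasis.of_linearEquiv E).exists_equiv hirr.ne_zero hdeg hbasis' he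
      fun i => i.2
    have hfinal := hbasis'.reindex σ
    rw [show (fun i : {i // k₀ i ≠ 0} => k₀ i) ∘ σ = e from funext hσ] at hfinal
    rw [hNdeg]
    exact DiffOp.exists_decomposition p hirr hδ hL_monic.ne_zero f he (fun i => hw₀ (σ i)) hfinal
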